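/- Let $F\in\mathbb R[x,y]$ be an irreducible polynomial with $\deg F\neq 1$, let $C=\{F=0\}\subset\mathbb A^2$ be the corresponding plane curve over $\mathbb R$ (so $C$ is not a line), and let $\pi\colon X\to C$ be its normalization. Let $\xi\in X(\mathbb R)$, let $A_\xi=\mathcal O_{X,\xi}$ with maximal ideal $\mathfrak m_\xi$ and discrete valuation $\mathrm{val}_\xi$ ($\mathrm{val}_\xi(f)=k$ iff $f\in\mathfrak m_\xi^k\setminus\mathfrak m_\xi^{k+1}$), and regard the affine coordinates $x,y$ as elements of $A_\xi$ via $\pi$. There are unique integers $1\le m<n$ (the contact orders at $\xi$) with $$\{0,m,n\}=\{\mathrm{val}_\xi(f)\colon 0\neq f\in\mathbb R+\mathbb Rx+\mathbb Ry\}.$$ Let $\otimes=\otimes_{\mathbb R}$. For $f\in A_\xi$ put $\delta(f)=f\otimes1-1\otimes f\in A_\xi\otimes A_\xi$. Let $s\in A_\xi$ be such that the $A_\xi$-module of Kähler differentials $\Omega_{A_\xi/\mathbb R}$ is freely generated by $ds$, define $\frac{df}{ds}\in A_\xi$ by $df=\frac{df}{ds}\,ds$ for $f\in A_\xi$, and let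 $$T=\Bigl(1\otimes\frac{dx}{ds}\Bigr)\delta(y)-\Bigl(1\otimes\frac{dy}{ds}\Bigr)\delta(x)\in A_\xi\otimes A_\xi$$ be the tangent tensor of $C$ relative to $s$. For $\alpha\in A_\xi\otimes A_\xi$ let $\overline\alpha\in\mathbb R$ be its residue at $(\xi,\xi)$, i.e. the image of $\alpha$ under the product map $A_\xi\otimes A_\xi\to A_\xi$ followed by evaluation $A_\xi\to\mathbb R$ at $\xi$. Then for every such $s$ and every local uniformizer $t\in A_\xi$ (i.e. $\mathrm{val}_\xi(t)=1$) there are a choice of sign $\pm$, elements $u_1,u_2\in A_\xi$, and elements $\alpha_i,\beta_i\in A_\xi\otimes A_\xi$ ($0\le i\le n-2$) with $\overline{\alpha_i}>0$ and $\overline{\beta_i}>0$ for all $i$, such that $$\pm T=(1\otimes t^{m-1})\cdot\sum_{i=0}^{n-2}(t^i\otimes t^{n-2-i})\cdot\bigl(\alpha_i\,\delta(u_1)^2+\beta_i\,\delta(u_2)^2\bigr)$$ in $A_\xi\otimes A_\xi$. -/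

import Mathlib

open scoped TensorProduct

noncomputable section

namespace PlaneCurve

/-- The coordinate ring `ℝ[C] = ℝ[x, y] / (F)` of the plane curve `C : F(x, y) = 0`. -/
def CoordRing (F : MvPolynomial (Fin 2) ℝ) : Type :=
  MvPolynomial (Fin 2) ℝ ⧸ Ideal.span {F}

instance instCommRingCoordRing (F : MvPolynomial (Fin 2) ℝ) : CommRing (CoordRing F) :=
  inferInstanceAs (CommRing (MvPolynomial (Fin 2) ℝ ⧸ Ideal.span {F}))

instance instAlgebraCoordRing (F : MvPolynomial (Fin 2) ℝ) : Algebra ℝ (CoordRing F) :=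
  inferInstanceAs (Algebra ℝ (MvPolynomial (Fin 2) ℝ ⧸ Ideal.span {F}))

/-- The restriction of polynomial functions to `C`. -/
def toCoordRing (F : MvPolynomial (Fin 2) ℝ) : MvPolynomial (Fin 2) ℝ →ₐ[ℝ] CoordRing F :=
  Ideal.Quotient.mkₐ ℝ (Ideal.span {F})

/-- The coordinate ring `ℝ[X]` of the normalization `X → C`: the integral closure of `ℝ[C]` in
its ring of fractions. -/
def NormRing (F : MvPolynomial (Fin 2) ℝ) : Type :=
  integralClosure (CoordRing F) (FractionRing (CoordRing F))

instance instCommRingNormRing (F : MvPolynomial (Fin 2) ℝ) : CommRing (NormRing F) :=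
  inferInstanceAs (CommRing (integralClosure (CoordRing F) (FractionRing (CoordRing F))))

instance instAlgebraNormRing (F : MvPolynomial (Fin 2) ℝ) : Algebra ℝ (NormRing F) :=
  inferInstanceAs (Algebra ℝ (integralClosure (CoordRing F) (FractionRing (CoordRing F))))

instance instAlgebraCoordRingNormRing (F : MvPolynomial (Fin 2) ℝ) :
    Algebra (CoordRing F) (NormRing F) :=
  inferInstanceAs
    (Algebra (CoordRing F) (integralClosure (CoordRing F) (FractionRing (CoordRing F))))

instance instIsScalarTowerNormRing (F : MvPolynomial (Fin 2) ℝ) :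
    IsScalarTower ℝ (CoordRing F) (NormRing F) :=
  inferInstanceAs (IsScalarTower ℝ (CoordRing F)
    (integralClosure (CoordRing F) (FractionRing (CoordRing F))))

/-- The set `X(ℝ)` of real points of the normalization. -/
abbrev RealPoint (F : MvPolynomial (Fin 2) ℝ) : Type :=
  NormRing F →ₐ[ℝ] ℝ

variable {F : MvPolynomial (Fin 2) ℝ}

/-- The maximal ideal of `ℝ[X]` corresponding to the point `ξ`. -/
def pointIdeal (ξ : RealPoint F) : Ideal (NormRing F) :=
  RingHom.ker (ξ : NormRing F →+* ℝ)

instance instIsPrimePointIdeal (ξ : RealPoint F) : (pointIdeal ξ).IsPrime :=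
  RingHom.ker_isPrime (ξ : NormRing F →+* ℝ)

/-- The local ring `A_ξ = 𝒪_{X, ξ}`. -/
def LocalRingAt (ξ : RealPoint F) : Type :=
  Localization.AtPrime (pointIdeal ξ)

instance instCommRingLocalRingAt (ξ : RealPoint F) : CommRing (LocalRingAt ξ) :=
  inferInstanceAs (CommRing (Localization.AtPrime (pointIdeal ξ)))

instance instIsLocalRingLocalRingAt (ξ : RealPoint F) : IsLocalRing (LocalRingAt ξ) :=
  inferInstanceAs (IsLocalRing (Localization.AtPrime (pointIdeal ξ)))

instance instAlgebraLocalRingAt (ξ : RealPoint F) : Algebra ℝ (LocalRingAt ξ) :=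
  inferInstanceAs (Algebra ℝ (Localization.AtPrime (pointIdeal ξ)))

instance instAlgebraNormRingLocalRingAt (ξ : RealPoint F) : Algebra (NormRing F) (LocalRingAt ξ) :=
  inferInstanceAs (Algebra (NormRing F) (Localization.AtPrime (pointIdeal ξ)))

instance instIsScalarTowerLocalRingAt (ξ : RealPoint F) :
    IsScalarTower ℝ (NormRing F) (LocalRingAt ξ) :=
  inferInstanceAs (IsScalarTower ℝ (NormRing F) (Localization.AtPrime (pointIdeal ξ)))

instance instIsLocalizationLocalRingAt (ξ : RealPoint F) :
    IsLocalization.AtPrime (LocalRingAt ξ) (pointIdeal ξ) :=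
  inferInstanceAs (IsLocalization.AtPrime (Localization.AtPrime (pointIdeal ξ)) (pointIdeal ξ))

/-- Evaluation of germs at `ξ`, as a homomorphism `A_ξ → ℝ`. -/
def evalAt (ξ : RealPoint F) : LocalRingAt ξ →ₐ[ℝ] ℝ :=
  IsLocalization.liftAlgHom (M := (pointIdeal ξ).primeCompl) (f := ξ)
    (fun a => isUnit_iff_ne_zero.mpr a.2)

/-- The germ at `ξ` of the pull-back to `X` of a polynomial function on the affine plane. -/
def germ (ξ : RealPoint F) (p : MvPolynomial (Fin 2) ℝ) : LocalRingAt ξ :=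
  algebraMap (NormRing F) (LocalRingAt ξ)
    (algebraMap (CoordRing F) (NormRing F) (toCoordRing F p))

/-- The first affine coordinate as an element of `A_ξ`. -/
def xGerm (ξ : RealPoint F) : LocalRingAt ξ := germ ξ (MvPolynomial.X 0)

/-- The second affine coordinate as an element of `A_ξ`. -/
def yGerm (ξ : RealPoint F) : LocalRingAt ξ := germ ξ (MvPolynomial.X 1)

/-- `val_ξ(f) = k`: the germ `f` lies in the `k`-th, but not in the `(k+1)`-st power of the
maximal ideal of `A_ξ`. -/
def HasVal (ξ : RealPoint F) (f : LocalRingAt ξ) (k : ℕ) : Prop :=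
  f ∈ IsLocalRing.maximalIdeal (LocalRingAt ξ) ^ k ∧
    f ∉ IsLocalRing.maximalIdeal (LocalRingAt ξ) ^ (k + 1)

/-- `t` is a local uniformizer at `ξ`. -/
def IsUniformizer (ξ : RealPoint F) (t : LocalRingAt ξ) : Prop := HasVal ξ t 1

/-- `(m, n)` are the contact orders at `ξ`: `1 ≤ m < n` and
`{0, m, n} = {val_ξ(f) : 0 ≠ f ∈ ℝ + ℝ x + ℝ y}`. -/
def IsContactOrders (ξ : RealPoint F) (m n : ℕ) : Prop :=
  1 ≤ m ∧ m < n ∧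
    ({0, m, n} : Set ℕ) =
      {k | ∃ f ∈ Submodule.span ℝ {1, xGerm ξ, yGerm ξ}, f ≠ 0 ∧ HasVal ξ f k}

section Tangent

variable {A : Type} [CommRing A] [Algebra ℝ A]

/-- `δ(f) = f ⊗ 1 - 1 ⊗ f`. -/
def delta (f : A) : A ⊗[ℝ] A := f ⊗ₜ[ℝ] 1 - 1 ⊗ₜ[ℝ] f

/-- The `A`-module `Ω_{A/ℝ}` of Kähler differentials is freely generated by `ds`. -/
def FreelyGenerates (s : A) : Prop :=
  ∀ ω : Ω[A⁄ℝ], ∃! a : A, ω = a • KaehlerDifferential.D ℝ A s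

/-- The derivative `df/ds`, i.e. the unique element with `df = (df/ds) ds`. -/
def derivAlong {s : A} (hs : FreelyGenerates s) (f : A) : A :=
  (hs (KaehlerDifferential.D ℝ A f)).choose

/-- The tensor `T_s(x, y) = (1 ⊗ dx/ds) δ(y) - (1 ⊗ dy/ds) δ(x)`. -/
def tangentTensor {s : A} (hs : FreelyGenerates s) (x y : A) : A ⊗[ℝ] A :=
  (1 ⊗ₜ[ℝ] derivAlong hs x) * delta y - (1 ⊗ₜ[ℝ] derivAlong hs y) * delta x

end Tangent

/-- The residue of `α ∈ A_ξ ⊗ A_ξ` at `(ξ, ξ)`: multiply out and evaluate at `ξ`. -/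
def residue (ξ : RealPoint F) : LocalRingAt ξ ⊗[ℝ] LocalRingAt ξ →ₐ[ℝ] ℝ :=
  (evalAt ξ).comp (Algebra.TensorProduct.lmul' ℝ)

end PlaneCurve

end

namespace PlaneCurve

/-! ### The diagonal ideal of `A ⊗ A` and the operators that detect vanishing along it. -/

section Tensor

variable {A : Type} [CommRing A] [Algebra ℝ A]

/-! Choose a uniformizer `u` and a second germ `u'` such that every germ is a fraction of
polynomials in `u, u'` with unit denominator. Then the kernel `I` of `A ⊗ A → A` is generated by
`δ(u)` and `δ(u')`. An affine change of coordinates only rescales the tangent tensor, so `x, y` may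
be replaced by `f = φ u^m` and `g = ψ u^n` with `φ, ψ` units. Put `a = u ⊗ 1`, `b = 1 ⊗ u`, and
split off `b^(m-1)` (`derivTensor_eq`).

For `f = u^m`, `g = u^n` and `D = d/du`, what remains is `m (a^n - b^n) - n b^(n-m) (a^m - b^m)`.
This is `(a - b)^2` times a form of degree `n - 2` in `a, b` with positive coefficients, obtained by
dividing out `a - b` twice with Abel summation (`sum_pow_mul_pow_eq`, `sum_Ico_sub_ite_pos`). For
general `φ, ψ` the same computation holds up to terms with residue zero, after multiplication by
some `q` of residue 1 with `q I ⊆ (δ(u))`; the remainder of the second division is controlled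
because the tensor vanishes to second order along the diagonal (`exists_sq_mul_reducedTensor_eq`).

The factor `q^2` cannot simply be inverted, since residue 1 does not make `q` a unit of `A ⊗ A`. The
reduced tensor lies in `(δ(u)^2, δ(u')^2)`, and `1 - q^2` lies in `(a, b)`; a truncated geometric
series for the inverse of `q^2` leaves an error of degree `n - 2` in `a, b` with coefficients of
residue zero. The relation `q^2 δ(u')^2 = p^2 δ(u)^2` then makes the coefficients of both squares
positive (`exists_reducedTensor_eq`).

The germs `u, u'` come from Noether normalization, the two-generator property of ideals in a
Dedekind domain, and Nakayama's lemma (`exists_pair_generating`). -/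

lemma delta_mul (f g : A) :
    delta (f * g) = (f ⊗ₜ[ℝ] 1) * delta g + (1 ⊗ₜ[ℝ] g) * delta f := by
  simp only [delta, mul_sub, Algebra.TensorProduct.tmul_mul_tmul, one_mul, mul_one, mul_comm g f]
  abel

lemma delta_add (f g : A) : delta (f + g) = delta f + delta g := by
  simp only [delta, TensorProduct.add_tmul, TensorProduct.tmul_add]
  ring

lemma delta_smul (c : ℝ) (f : A) : delta (c • f) = c • delta f := by
  simp only [delta, TensorProduct.smul_tmul', TensorProduct.tmul_smul, smul_sub]

lemma delta_algebraMap (c : ℝ) : delta (algebraMap ℝ A c) = 0 := by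
  rw [Algebra.algebraMap_eq_smul_one, delta_smul, delta, sub_self, smul_zero]

/-- The product map `A ⊗ A → A`. -/
noncomputable abbrev mulHom (A : Type) [CommRing A] [Algebra ℝ A] : A ⊗[ℝ] A →ₐ[ℝ] A :=
  Algebra.TensorProduct.lmul' ℝ

@[simp] lemma mulHom_delta (f : A) : mulHom A (delta f) = 0 := by
  simp [delta]

/-- The derivation `f ⊗ g ↦ D(f) g` of `A ⊗ A` with values in `A`. -/
noncomputable def tensorDeriv (D : Derivation ℝ A A) : A ⊗[ℝ] A →ₗ[ℝ] A :=
  (mulHom A).toLinearMap ∘ₗ TensorProduct.map D.toLinearMap LinearMap.id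

@[simp] lemma tensorDeriv_tmul (D : Derivation ℝ A A) (f g : A) :
    tensorDeriv D (f ⊗ₜ g) = D f * g := by
  simp [tensorDeriv]

@[simp] lemma tensorDeriv_delta (D : Derivation ℝ A A) (f : A) :
    tensorDeriv D (delta f) = D f := by
  simp [delta]

lemma tensorDeriv_mul (D : Derivation ℝ A A) (r s : A ⊗[ℝ] A) :
    tensorDeriv D (r * s) =
      mulHom A r * tensorDeriv D s + mulHom A s * tensorDeriv D r := by
  induction r with
  | zero => simp
  | add x y hx hy => simp only [add_mul, map_add, hx, hy]; ring
  | tmul f g =>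
    induction s with
    | zero => simp
    | add x y hx hy => simp only [mul_add, map_add, hx, hy]; ring
    | tmul f' g' =>
      simp [Algebra.TensorProduct.tmul_mul_tmul]
      ring

lemma delta_mem_span_of_mem_adjoin {S : Set A} {f : A} (hf : f ∈ Algebra.adjoin ℝ S) :
    delta f ∈ Ideal.span (delta '' S) := by
  induction hf using Algebra.adjoin_induction with
  | mem x hx => exact Ideal.subset_span ⟨x, hx, rfl⟩
  | algebraMap r => rw [delta_algebraMap]; exact zero_mem _
  | add x y _ _ hx hy => rw [delta_add]; exact add_mem hx hy
  | mul x y _ _ hx hy =>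
    rw [delta_mul]
    exact add_mem (Ideal.mul_mem_left _ _ hy) (Ideal.mul_mem_left _ _ hx)

/-- The quotient rule: the product rule for `δ(f g)` can be solved for `δ(f)` when `g` is a unit. -/
lemma delta_mem_of_mul {J : Ideal (A ⊗[ℝ] A)} {f g : A} (hg : IsUnit g)
    (hJ : delta g ∈ J) (hfg : delta (f * g) ∈ J) : delta f ∈ J := by
  obtain ⟨g', hg'⟩ := hg.exists_right_inv
  have h : delta f = (1 ⊗ₜ g') * (delta (f * g) - (f ⊗ₜ[ℝ] 1) * delta g) := by
    rw [delta_mul, add_sub_cancel_left, ← mul_assoc, Algebra.TensorProduct.tmul_mul_tmul,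
      mul_comm g', hg', one_mul, ← Algebra.TensorProduct.one_def, one_mul]
  rw [h]
  exact Ideal.mul_mem_left _ _ (sub_mem hfg (Ideal.mul_mem_left _ _ hJ))

/-- Modulo the `δ(f)`, both copies of `A` are identified, so `f ⊗ g` becomes `1 ⊗ f g`. -/
lemma sub_mem_of_delta_mem {J : Ideal (A ⊗[ℝ] A)} (hJ : ∀ f : A, delta f ∈ J)
    (r : A ⊗[ℝ] A) : r - 1 ⊗ₜ mulHom A r ∈ J := by
  induction r with
  | zero => simp
  | add x y hx hy =>
    rw [map_add, TensorProduct.tmul_add, add_sub_add_comm]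
    exact add_mem hx hy
  | tmul f g =>
    have h : f ⊗ₜ[ℝ] g - 1 ⊗ₜ mulHom A (f ⊗ₜ g) = (1 ⊗ₜ g) * delta f := by
      simp [delta, mul_sub, mul_comm g f]
    rw [h]
    exact Ideal.mul_mem_left _ _ (hJ f)

/-- If every `f ∈ A` is a fraction of polynomials in `u₁, u₂` with unit denominators, the kernel
of the product map `A ⊗ A → A` is generated by `δ(u₁)` and `δ(u₂)`. -/
lemma exists_eq_of_mulHom_eq_zero {u₁ u₂ : A}
    (hgen : ∀ f : A, ∃ g ∈ Algebra.adjoin ℝ {u₁, u₂}, IsUnit g ∧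
      f * g ∈ Algebra.adjoin ℝ {u₁, u₂}) {r : A ⊗[ℝ] A} (hr : mulHom A r = 0) :
    ∃ x y, r = x * delta u₁ + y * delta u₂ := by
  have hJ : ∀ f : A, delta f ∈ Ideal.span (delta '' {u₁, u₂}) := fun f => by
    obtain ⟨g, hg, hgu, hfg⟩ := hgen f
    exact delta_mem_of_mul hgu (delta_mem_span_of_mem_adjoin hg)
      (delta_mem_span_of_mem_adjoin hfg)
  have h := sub_mem_of_delta_mem hJ r
  rw [hr, TensorProduct.tmul_zero, sub_zero, Set.image_pair, Ideal.mem_span_pair] at h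
  obtain ⟨x, y, h⟩ := h
  exact ⟨x, y, h.symm⟩

variable (ev : A →ₐ[ℝ] ℝ)

/-- An element of `A ⊗ A` minus its residue is in the ideal generated by `u ⊗ 1`, `1 ⊗ u`. -/
lemma exists_eq_residue_add {u : A} (hu : ∀ f, ev f = 0 → u ∣ f) (r : A ⊗[ℝ] A) :
    ∃ x y, r = algebraMap ℝ (A ⊗[ℝ] A) (ev (mulHom A r)) +
      ((u ⊗ₜ 1) * x + (1 ⊗ₜ u) * y) := by
  have key : ∀ f : A, ∃ g, f = algebraMap ℝ A (ev f) + u * g := fun f => by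
    obtain ⟨g, hg⟩ := hu (f - algebraMap ℝ A (ev f)) (by simp)
    exact ⟨g, by rw [← hg]; ring⟩
  induction r with
  | zero => exact ⟨0, 0, by simp⟩
  | add r s hr hs =>
    obtain ⟨x, y, h⟩ := hr
    obtain ⟨x', y', h'⟩ := hs
    refine ⟨x + x', y + y', ?_⟩
    nth_rw 1 [h, h']
    simp only [map_add]
    ring
  | tmul f g =>
    obtain ⟨f', hf⟩ := key f
    obtain ⟨g', hg⟩ := key g
    refine ⟨f' ⊗ₜ g, algebraMap ℝ A (ev f) ⊗ₜ g', ?_⟩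
    have h0 : ev (mulHom A (f ⊗ₜ[ℝ] g)) = ev f * ev g := by simp
    rw [h0]
    generalize ev f = c at hf ⊢
    generalize ev g = d at hg ⊢
    have h1 : f ⊗ₜ[ℝ] g = algebraMap ℝ A c ⊗ₜ[ℝ] algebraMap ℝ A d +
        (algebraMap ℝ A c ⊗ₜ[ℝ] (u * g') + (u * f') ⊗ₜ[ℝ] g) := by
      rw [← add_assoc, ← TensorProduct.tmul_add, ← hg, ← TensorProduct.add_tmul, ← hf]
    rw [h1]
    simp only [Algebra.TensorProduct.tmul_mul_tmul, Algebra.algebraMap_eq_smul_one,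
      TensorProduct.tmul_smul, ← TensorProduct.smul_tmul', Algebra.TensorProduct.one_def, smul_smul,
      mul_comm c, one_mul, mul_smul_comm]
    abel

end Tensor
-- Division of binary forms by `a - b`, and the sign of the resulting coefficients.
section Sums

open Finset

variable {R : Type*} [CommRing R]

/-- Abel summation: division by `a - b` turns the coefficients into their tail sums, and the
remainder is the value at `a = b`. -/
lemma sum_pow_mul_pow_eq (a b : R) (h : ℕ → R) (k : ℕ) :
    ∑ i ∈ range (k + 1), a ^ i * b ^ (k - i) * h i =
      (a - b) * ∑ j ∈ range k, a ^ j * b ^ (k - 1 - j) * ∑ i ∈ Ico (j + 1) (k + 1), h i +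
        b ^ k * ∑ i ∈ range (k + 1), h i := by
  induction k with
  | zero => simp
  | succ k ih =>
    have h1 : ∑ i ∈ range (k + 1), a ^ i * b ^ (k + 1 - i) * h i =
        b * ∑ i ∈ range (k + 1), a ^ i * b ^ (k - i) * h i := by
      rw [mul_sum]
      refine sum_congr rfl fun i hi => ?_
      rw [Nat.succ_sub (Nat.lt_succ_iff.mp (mem_range.mp hi)), pow_succ]
      ring
    have h2 : ∑ j ∈ range (k + 1), a ^ j * b ^ (k - j) * ∑ i ∈ Ico (j + 1) (k + 2), h i =
        b * (∑ j ∈ range k, a ^ j * b ^ (k - 1 - j) * ∑ i ∈ Ico (j + 1) (k + 1), h i) +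
          (∑ j ∈ range (k + 1), a ^ j * b ^ (k - j)) * h (k + 1) := by
      have h3 : ∀ j ∈ range (k + 1), a ^ j * b ^ (k - j) * ∑ i ∈ Ico (j + 1) (k + 2), h i =
          a ^ j * b ^ (k - j) * (∑ i ∈ Ico (j + 1) (k + 1), h i) +
            a ^ j * b ^ (k - j) * h (k + 1) := fun j hj => by
        rw [sum_Ico_succ_top (by have := mem_range.mp hj; omega), mul_add]
      rw [sum_congr rfl h3, sum_add_distrib, ← sum_mul, sum_range_succ, Ico_self, sum_empty,
        mul_zero, add_zero, mul_sum]
      congr 1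
      refine sum_congr rfl fun j hj => ?_
      rw [show k - j = k - 1 - j + 1 by have := mem_range.mp hj; omega, pow_succ]
      ring
    have h4 : (∑ j ∈ range (k + 1), a ^ j * b ^ (k - j)) * (a - b) =
        a ^ (k + 1) - b ^ (k + 1) := by
      simpa using (Commute.all a b).geom_sum₂_mul (k + 1)
    rw [sum_range_succ, h1, ih, Nat.add_sub_cancel, h2, sum_range_succ _ (k + 1), Nat.sub_self]
    linear_combination (-h (k + 1)) * h4

lemma sum_pow_mul_pow_ite (a b c : R) {m n : ℕ} (hmn : m ≤ n) :
    (∑ i ∈ range n, a ^ i * b ^ (n - 1 - i) * if i < m then c else 0) * (a - b) =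
      b ^ (n - m) * c * (a ^ m - b ^ m) := by
  have h1 : ∑ i ∈ range n, a ^ i * b ^ (n - 1 - i) * (if i < m then c else 0) =
      b ^ (n - m) * c * ∑ i ∈ range m, a ^ i * b ^ (m - 1 - i) := by
    rw [← sum_subset (range_mono hmn), mul_sum]
    · refine sum_congr rfl fun i hi => ?_
      have hi := mem_range.mp hi
      rw [if_pos hi, show n - 1 - i = (n - m) + (m - 1 - i) by omega, pow_add]
      ring
    · intro i _ hi
      rw [if_neg (by simpa using hi), mul_zero]
  rw [h1, mul_assoc, (Commute.all a b).geom_sum₂_mul]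

/-- The first division by `a - b`. Primes stand for the copy in the second tensor factor; one splits
`ψ a^n - ψ' b^n = ψ (a^n - b^n) + (ψ - ψ') b^n`, and likewise for `φ`. -/
lemma mul_sub_eq_mul_sum (a b q φ φ' ψ ψ' φ₁ ψ₁ v w : R) {m n : ℕ} (hmn : m ≤ n)
    (hφ : q * (φ - φ') = φ₁ * (a - b)) (hψ : q * (ψ - ψ') = ψ₁ * (a - b)) :
    q * (v * (ψ * a ^ n - ψ' * b ^ n) - b ^ (n - m) * w * (φ * a ^ m - φ' * b ^ m)) =
      (a - b) * (∑ i ∈ range n, a ^ i * b ^ (n - 1 - i) *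
          (v * q * ψ - if i < m then w * q * φ else 0) +
        b ^ n * (v * ψ₁ - w * φ₁)) := by
  have h1 := sum_pow_mul_pow_ite a b (w * q * φ) hmn
  have h2 := (Commute.all a b).geom_sum₂_mul n
  have h3 : b ^ n = b ^ (n - m) * b ^ m := by rw [← pow_add, Nat.sub_add_cancel hmn]
  simp only [mul_sub, sum_sub_distrib, ← sum_mul]
  linear_combination (-(v * q * ψ)) * h2 + h1 + (v * b ^ n) * hψ - b ^ (n - m) * w * b ^ m * hφ +
    w * φ₁ * (a - b) * h3

lemma add_pow_eq_sum (a b x y : R) (k : ℕ) :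
    ∃ c : ℕ → R, (a * x + b * y) ^ k = ∑ i ∈ range (k + 1), a ^ i * b ^ (k - i) * c i := by
  refine ⟨fun i => x ^ i * y ^ (k - i) * (k.choose i : R), ?_⟩
  rw [add_pow]
  exact sum_congr rfl fun i _ => by rw [mul_pow, mul_pow]; ring

/-- The tail sum is `m (n - 1 - j)` if `m ≤ j + 1`, and `(n - m) (j + 1)` otherwise. -/
lemma sum_Ico_sub_ite_pos {m n j : ℕ} (hm : 1 ≤ m) (hmn : m < n) (hj : j < n - 1) :
    0 < ∑ i ∈ Ico (j + 1) n, ((m : ℝ) - if i < m then (n : ℝ) else 0) := by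
  rcases le_or_gt m (j + 1) with h | h
  · refine sum_pos (fun i hi => ?_) ⟨j + 1, by simp; omega⟩
    rw [if_neg (by have := mem_Ico.mp hi; omega), sub_zero]
    exact_mod_cast hm
  · rw [← sum_Ico_consecutive _ h.le hmn.le,
      sum_congr rfl (g := fun _ => (m : ℝ) - n) fun i hi => by rw [if_pos (mem_Ico.mp hi).2],
      sum_congr rfl (s₁ := Ico m n) (g := fun _ => (m : ℝ)) fun i hi => by
        rw [if_neg (not_lt.mpr (mem_Ico.mp hi).1), sub_zero]]
    simp only [sum_const, Nat.card_Ico, nsmul_eq_mul, Nat.cast_sub h.le, Nat.cast_sub hmn.le]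
    have h1 : (0 : ℝ) < n - m := by rw [sub_pos]; exact_mod_cast hmn
    have h2 : (0 : ℝ) < ((j + 1 : ℕ) : ℝ) := by positivity
    have := mul_pos h1 h2
    linarith

end Sums

/-! ### Substitutes for localizing `A ⊗ A` at the diagonal point. -/

section Diagonal

variable {A : Type} [CommRing A] [Algebra ℝ A] (ev : A →ₐ[ℝ] ℝ)

/-- Modulo the kernel, `q` equals `1 ⊗ mulHom A q`, which is a unit. Applied to colon ideals, this
removes a factor `q` from a membership. -/
lemma eq_top_of_mem_of_kernel_le {J : Ideal (A ⊗[ℝ] A)} (hunit : ∀ f, ev f ≠ 0 → IsUnit f)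
    {q : A ⊗[ℝ] A} (hq : ev (mulHom A q) ≠ 0) (hqJ : q ∈ J)
    (hJ : ∀ r, mulHom A r = 0 → r ∈ J) : J = ⊤ := by
  obtain ⟨g, hg⟩ := (hunit _ hq).exists_right_inv
  have h := sub_mem_of_delta_mem (fun f => hJ _ (mulHom_delta f)) q
  have h1 := J.mul_mem_left (1 ⊗ₜ g) ((Submodule.sub_mem_iff_right _ hqJ).mp h)
  rwa [Algebra.TensorProduct.tmul_mul_tmul, mul_comm g, hg, one_mul,
    ← Algebra.TensorProduct.one_def, ← Ideal.eq_top_iff_one] at h1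

/-- Near the diagonal, `δ(u₂)` is a multiple of `δ(u₁)` if `u₁` generates the maximal ideal. -/
lemma exists_mul_delta_eq {u₁ u₂ : A} (hu : ∀ f, ev f = 0 → u₁ ∣ f) (hu0 : ev u₁ = 0)
    (hI : ∀ r, mulHom A r = 0 → ∃ x y, r = x * delta u₁ + y * delta u₂) :
    ∃ q p, ev (mulHom A q) = 1 ∧ q * delta u₂ = p * delta u₁ := by
  obtain ⟨g, hg⟩ := hu (u₂ - algebraMap ℝ A (ev u₂)) (by simp)
  obtain ⟨x, y, h⟩ := hI (delta g) (mulHom_delta g)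
  have h2 : delta u₂ = (u₁ ⊗ₜ[ℝ] 1) * delta g + (1 ⊗ₜ[ℝ] g) * delta u₁ := by
    have h := delta_add (u₂ - algebraMap ℝ A (ev u₂)) (algebraMap ℝ A (ev u₂))
    rwa [sub_add_cancel, delta_algebraMap, add_zero, hg, delta_mul] at h
  -- Expand `δ(g)` in `h2` and move its `δ(u₂)` term to the left; the factor `u₁ ⊗ 1` keeps the
  -- residue equal to 1.
  refine ⟨1 - (u₁ ⊗ₜ 1) * y, (u₁ ⊗ₜ 1) * x + 1 ⊗ₜ g, by simp [hu0], ?_⟩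
  rw [h] at h2
  linear_combination h2

end Diagonal
-- Second-order vanishing of the tangent tensor and extraction of `δ(u)^2`.
section Core

open Finset

variable {A : Type} [CommRing A] [Algebra ℝ A]

/-- The tangent tensor `(1 ⊗ Df) δ(g) - (1 ⊗ Dg) δ(f)` with respect to a derivation `D`. -/
noncomputable def derivTensor (D : Derivation ℝ A A) (f g : A) : A ⊗[ℝ] A :=
  (1 ⊗ₜ[ℝ] D f) * delta g - (1 ⊗ₜ[ℝ] D g) * delta f

lemma deriv_mul_pow (D : Derivation ℝ A A) (φ u : A) {m : ℕ} (hm : 1 ≤ m) :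
    D (φ * u ^ m) = u ^ (m - 1) * (m * φ * D u + u * D φ) := by
  obtain ⟨k, rfl⟩ := Nat.exists_eq_add_of_le' hm
  simp only [Derivation.leibniz, Derivation.leibniz_pow, smul_eq_mul, nsmul_eq_mul,
    Nat.add_sub_cancel, Nat.cast_add, Nat.cast_one]
  ring

lemma delta_mul_pow (φ u : A) (m : ℕ) :
    delta (φ * u ^ m) =
      (φ ⊗ₜ 1) * (u ⊗ₜ[ℝ] 1) ^ m - (1 ⊗ₜ φ) * ((1 : A) ⊗ₜ[ℝ] u) ^ m := by
  simp [delta, Algebra.TensorProduct.tmul_pow]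

variable (ev : A →ₐ[ℝ] ℝ)

/-- The part of the tangent tensor of `φ u ^ m` and `ψ u ^ n` left after removing the factor
`1 ⊗ u ^ (m - 1)`. -/
noncomputable def reducedTensor (D : Derivation ℝ A A) (φ ψ u : A) (m n : ℕ) : A ⊗[ℝ] A :=
  (1 ⊗ₜ (m * φ * D u + u * D φ)) * delta (ψ * u ^ n) -
    (1 ⊗ₜ u) ^ (n - m) * (1 ⊗ₜ (n * ψ * D u + u * D ψ)) * delta (φ * u ^ m)

lemma derivTensor_eq (D : Derivation ℝ A A) (φ ψ u : A) {m n : ℕ} (hm : 1 ≤ m) (hmn : m < n) :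
    derivTensor D (φ * u ^ m) (ψ * u ^ n) =
      (1 ⊗ₜ (u ^ (m - 1))) * reducedTensor D φ ψ u m n := by
  rw [derivTensor, reducedTensor, deriv_mul_pow D φ u hm, deriv_mul_pow D ψ u (by omega),
    show n - 1 = (m - 1) + (n - m) by omega]
  simp only [mul_sub, ← mul_assoc, Algebra.TensorProduct.tmul_mul_tmul,
    Algebra.TensorProduct.tmul_pow, one_pow, mul_one, pow_add]

lemma mulHom_reducedTensor (D : Derivation ℝ A A) (φ ψ u : A) (m n : ℕ) :
    mulHom A (reducedTensor D φ ψ u m n) = 0 := by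
  simp [reducedTensor, -Algebra.TensorProduct.lmul'_apply_tmul]

/-- Together with `mulHom_reducedTensor` this says that the tensor vanishes to second order along
the diagonal. -/
lemma tensorDeriv_reducedTensor (D : Derivation ℝ A A) (φ ψ u : A) {m n : ℕ}
    (hm : 1 ≤ m) (hmn : m < n) : tensorDeriv D (reducedTensor D φ ψ u m n) = 0 := by
  simp only [reducedTensor, map_sub, tensorDeriv_mul, mulHom_delta, tensorDeriv_delta, map_mul,
    map_pow, Algebra.TensorProduct.lmul'_apply_tmul, one_mul, zero_mul, add_zero]
  rw [deriv_mul_pow D φ u hm, deriv_mul_pow D ψ u (by omega),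
    show n - 1 = (m - 1) + (n - m) by omega, pow_add]
  ring

/-- After multiplication by an element `q ^ 2` that is nonzero on the diagonal at the point, the
reduced tangent tensor is `δ(u) ^ 2` times a form with coefficients of constant sign. -/
lemma exists_sq_mul_reducedTensor_eq [IsDomain A] (D : Derivation ℝ A A) {u φ ψ : A}
    (hu0 : ev u = 0) (hDu : D u ≠ 0) {q : A ⊗[ℝ] A} (hq : ev (mulHom A q) = 1)
    (hqI : ∀ r, mulHom A r = 0 → ∃ x, q * r = x * delta u) (hu : u ≠ 0)
    {m n : ℕ} (hm : 1 ≤ m) (hmn : m < n) :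
    ∃ e : ℕ → A ⊗[ℝ] A,
      (∀ j, ev (mulHom A (e j)) = ev φ * ev ψ * ev (D u) *
        ∑ i ∈ Ico (j + 1) n, ((m : ℝ) - if i < m then (n : ℝ) else 0)) ∧
      q ^ 2 * reducedTensor D φ ψ u m n = delta u ^ 2 *
        ∑ j ∈ range (n - 1), (u ⊗ₜ 1) ^ j * (1 ⊗ₜ u) ^ (n - 2 - j) * e j := by
  obtain ⟨φ₁, hφ⟩ := hqI (delta φ) (mulHom_delta φ)
  obtain ⟨ψ₁, hψ⟩ := hqI (delta ψ) (mulHom_delta ψ)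
  obtain ⟨k, rfl⟩ : ∃ k, n = k + 2 := ⟨n - 2, by omega⟩
  set a : A ⊗[ℝ] A := u ⊗ₜ 1 with ha
  set b : A ⊗[ℝ] A := 1 ⊗ₜ u with hb
  set v : A ⊗[ℝ] A := 1 ⊗ₜ (m * φ * D u + u * D φ) with hv
  set w : A ⊗[ℝ] A := 1 ⊗ₜ ((k + 2 : ℕ) * ψ * D u + u * D ψ) with hw
  set T := reducedTensor D φ ψ u m (k + 2) with hT
  have hd : delta u = a - b := rfl
  set h : ℕ → A ⊗[ℝ] A := fun i =>
    v * q * (ψ ⊗ₜ 1) - if i < m then w * q * (φ ⊗ₜ 1) else 0 with hh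
  set z : A ⊗[ℝ] A := v * ψ₁ - w * φ₁ with hz
  have key : q * T = delta u * (∑ i ∈ range (k + 2), a ^ i * b ^ (k + 1 - i) * h i +
      b ^ (k + 2) * z) := by
    have h1 := mul_sub_eq_mul_sum a b q (φ ⊗ₜ 1) (1 ⊗ₜ φ) (ψ ⊗ₜ 1) (1 ⊗ₜ ψ) φ₁ ψ₁ v w hmn.le hφ hψ
    rw [← delta_mul_pow, ← delta_mul_pow] at h1
    exact h1
  have hsum := sum_pow_mul_pow_eq a b h (k + 1)
  set S := ∑ j ∈ range (k + 1), a ^ j * b ^ (k - j) * ∑ i ∈ Ico (j + 1) (k + 2), h i with hS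
  set W := ∑ i ∈ range (k + 2), h i + b * z with hW
  have key2 : q * T = delta u * (delta u * S + b ^ (k + 1) * W) := by
    rw [key, hsum, hW, hd]
    simp only [Nat.add_sub_cancel]
    ring
  -- Applying `tensorDeriv D` to `key2` gives zero on the left and `u^(k+1) W D(u)`, restricted to
  -- the diagonal, on the right.
  have hW0 : mulHom A W = 0 := by
    have h1 := congrArg (tensorDeriv D) key2
    rw [tensorDeriv_mul, tensorDeriv_mul, mulHom_delta, tensorDeriv_delta, hT,
      tensorDeriv_reducedTensor D φ ψ u hm hmn, mulHom_reducedTensor] at h1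
    simp only [mul_zero, zero_mul, add_zero, zero_add, map_add, map_mul, mulHom_delta, map_pow]
      at h1
    have h2 : mulHom A b = u := by simp [hb]
    rw [h2] at h1
    exact (mul_eq_zero.mp ((mul_eq_zero.mp h1.symm).resolve_right hDu)).resolve_left
      (pow_ne_zero _ hu)
  obtain ⟨x, hx⟩ := hqI W hW0
  -- The remainder `b^(k+1) x` is absorbed into the coefficient of `b^k`; the spare factor `b` has
  -- residue zero.
  refine ⟨fun j => q * (∑ i ∈ Ico (j + 1) (k + 2), h i) + if j = 0 then b * x else 0, ?_, ?_⟩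
  · intro j
    have h1 : ∀ i, ev (mulHom A (h i)) =
        ev φ * ev ψ * ev (D u) * ((m : ℝ) - if i < m then ((k + 2 : ℕ) : ℝ) else 0) := fun i => by
      simp only [hh, hv, hw, map_sub, map_mul, Algebra.TensorProduct.lmul'_apply_tmul, hq, map_add,
        one_mul, mul_one, hu0, zero_mul, add_zero, map_natCast]
      split_ifs
      · simp only [map_mul, Algebra.TensorProduct.lmul'_apply_tmul, hq, map_add,
          one_mul, mul_one, hu0, zero_mul, add_zero, map_natCast]
        ring
      · simp only [map_zero]
        ring
    have h2 : ev (mulHom A (if j = 0 then b * x else 0)) = 0 := by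
      split_ifs <;> simp [hb, hu0]
    rw [map_add, map_add, h2, map_mul, map_mul, hq, map_sum, map_sum, sum_congr rfl fun i _ => h1 i,
      ← mul_sum, one_mul, add_zero]
  · have h1 : ∑ j ∈ range (k + 1), a ^ j * b ^ (k - j) *
          (q * (∑ i ∈ Ico (j + 1) (k + 2), h i) + if j = 0 then b * x else 0) =
        q * S + b ^ (k + 1) * x := by
      simp only [mul_add, sum_add_distrib, hS, mul_sum]
      congr 1
      · refine sum_congr rfl fun j _ => sum_congr rfl fun i _ => ?_
        ring
      · rw [sum_eq_single 0 (fun j _ hj => by simp [hj]) (by simp)]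
        simp only [pow_zero, if_true, Nat.sub_zero, pow_succ]
        ring
    change q ^ 2 * T = delta u ^ 2 * ∑ j ∈ range (k + 1), a ^ j * b ^ (k - j) * _
    rw [h1]
    linear_combination q * key2 + delta u * b ^ (k + 1) * hx

end Core
-- Removal of the factor `q^2` and positivity of both coefficients.
section Decomposition

open Finset

variable {A : Type} [CommRing A] [Algebra ℝ A] (ev : A →ₐ[ℝ] ℝ)

lemma exists_reducedTensor_eq [IsDomain A] (D : Derivation ℝ A A) {u u' φ ψ : A}
    (hunit : ∀ f, ev f ≠ 0 → IsUnit f) (hdvd : ∀ f, ev f = 0 → u ∣ f) (hu0 : ev u = 0)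
    (hu : u ≠ 0) (hI : ∀ r, mulHom A r = 0 → ∃ x y, r = x * delta u + y * delta u')
    (hDu : ev (D u) ≠ 0) (hφ : ev φ ≠ 0) (hψ : ev ψ ≠ 0) {m n : ℕ} (hm : 1 ≤ m) (hmn : m < n) :
    ∃ α β : ℕ → A ⊗[ℝ] A,
      (∀ j ∈ range (n - 1), 0 < ev φ * ev ψ * ev (D u) * ev (mulHom A (α j)) ∧
        0 < ev φ * ev ψ * ev (D u) * ev (mulHom A (β j))) ∧
      reducedTensor D φ ψ u m n = ∑ j ∈ range (n - 1), (u ⊗ₜ 1) ^ j * (1 ⊗ₜ u) ^ (n - 2 - j) *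
        (α j * delta u ^ 2 + β j * delta u' ^ 2) := by
  obtain ⟨q, p, hq, hqp⟩ := exists_mul_delta_eq ev hdvd hu0 hI
  have hqI : ∀ r, mulHom A r = 0 → ∃ x, q * r = x * delta u := fun r hr => by
    obtain ⟨x, y, rfl⟩ := hI r hr
    exact ⟨q * x + y * p, by linear_combination y * hqp⟩
  obtain ⟨e, he, hT⟩ := exists_sq_mul_reducedTensor_eq ev (φ := φ) (ψ := ψ) D hu0
    (fun h => hDu (by rw [h, map_zero])) hq hqI hu hm hmn
  set K := ev φ * ev ψ * ev (D u)
  have hK0 : K ≠ 0 := mul_ne_zero (mul_ne_zero hφ hψ) hDu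
  set T := reducedTensor D φ ψ u m n with hT0
  set J : Ideal (A ⊗[ℝ] A) := Ideal.span {delta u ^ 2, delta u' ^ 2}
  have hJ1 : delta u ^ 2 ∈ J := Ideal.subset_span (by simp)
  have hJ2 : delta u' ^ 2 ∈ J := Ideal.subset_span (by simp)
  have hJ12 : delta u * delta u' ∈ J := by
    have h : J.colon {delta u * delta u'} = ⊤ := by
      refine eq_top_of_mem_of_kernel_le ev hunit (q := q) (by simp [hq]) ?_ fun r hr => ?_
      · rw [Submodule.mem_colon_singleton, smul_eq_mul,
          show q * (delta u * delta u') = p * delta u ^ 2 by linear_combination delta u * hqp]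
        exact J.mul_mem_left _ hJ1
      · obtain ⟨x, y, rfl⟩ := hI r hr
        rw [Submodule.mem_colon_singleton, smul_eq_mul,
          show (x * delta u + y * delta u') * (delta u * delta u') =
            x * delta u' * delta u ^ 2 + y * delta u * delta u' ^ 2 by ring]
        exact add_mem (J.mul_mem_left _ hJ1) (J.mul_mem_left _ hJ2)
    have h1 : (1 : A ⊗[ℝ] A) ∈ J.colon {delta u * delta u'} := h ▸ Submodule.mem_top
    simpa [Submodule.mem_colon_singleton] using h1
  -- Since `T` lies in the kernel, multiplying it by the kernel lands in the square of the kernel,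
  -- which is inside `J` by `hJ12`.
  have hTJ : T ∈ J := by
    have h : J.colon {T} = ⊤ := by
      refine eq_top_of_mem_of_kernel_le ev hunit (q := q ^ 2) (by simp [hq]) ?_ fun r hr => ?_
      · rw [Submodule.mem_colon_singleton, smul_eq_mul, hT, mul_comm]
        exact J.mul_mem_left _ hJ1
      · obtain ⟨x, y, rfl⟩ := hI r hr
        obtain ⟨x', y', hxy⟩ := hI T (mulHom_reducedTensor D φ ψ u m n)
        rw [Submodule.mem_colon_singleton, smul_eq_mul, hxy,
          show (x * delta u + y * delta u') * (x' * delta u + y' * delta u') =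
            x * x' * delta u ^ 2 + y * y' * delta u' ^ 2 +
              (x * y' + y * x') * (delta u * delta u') by ring]
        exact add_mem (add_mem (J.mul_mem_left _ hJ1) (J.mul_mem_left _ hJ2))
          (J.mul_mem_left _ hJ12)
    have h1 : (1 : A ⊗[ℝ] A) ∈ J.colon {T} := h ▸ Submodule.mem_top
    simpa [Submodule.mem_colon_singleton] using h1
  obtain ⟨τ, τ', hτ⟩ := Ideal.mem_span_pair.mp hTJ
  obtain ⟨k, rfl⟩ : ∃ k, n = k + 2 := ⟨n - 2, by omega⟩
  obtain ⟨x, y, hxy⟩ := exists_eq_residue_add ev hdvd (1 - q ^ 2)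
  have hres : ev (mulHom A (1 - q ^ 2)) = 0 := by simp [hq]
  rw [hres, map_zero, zero_add] at hxy
  -- Only `k` of the `k + 1` factors `1 - q^2` of the error are expanded; the last one gives the
  -- coefficients residue zero.
  obtain ⟨c, hc⟩ := add_pow_eq_sum (u ⊗ₜ[ℝ] (1 : A)) ((1 : A) ⊗ₜ[ℝ] u) x y k
  rw [← hxy] at hc
  set s := ∑ i ∈ range (k + 1), (1 - q ^ 2) ^ i with hs
  have hs1 : ev (mulHom A s) = 1 := by
    rw [hs, map_sum, map_sum, sum_eq_single 0
      (fun i _ hi => by rw [map_pow, map_pow, hres, zero_pow hi]) (by simp)]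
    simp
  have hgeom : q ^ 2 * s = 1 - (1 - q ^ 2) ^ (k + 1) := by
    have := mul_neg_geom_sum (1 - q ^ 2) (k + 1)
    rwa [sub_sub_cancel] at this
  set P := ev (mulHom A p)
  set N := fun j : ℕ =>
    K * ∑ i ∈ Ico (j + 1) (k + 2), ((m : ℝ) - if i < m then ((k + 2 : ℕ) : ℝ) else 0) with hN
  -- Adding `ρ (q^2 δ(u')^2 - p^2 δ(u)^2) = 0` gives the residues `N - ρ P^2` and `ρ`; this value of
  -- `ρ` makes them equal.
  set ρ := fun j : ℕ => algebraMap ℝ (A ⊗[ℝ] A) (N j / (1 + P ^ 2)) with hρ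
  have hres_alg : ∀ r : ℝ, ev (mulHom A (algebraMap ℝ (A ⊗[ℝ] A) r)) = r := fun r => by
    rw [AlgHom.commutes, AlgHom.commutes, Algebra.algebraMap_self_apply]
  have hsq : q ^ 2 * delta u' ^ 2 = p ^ 2 * delta u ^ 2 := by
    linear_combination (q * delta u' + p * delta u) * hqp
  refine ⟨fun j => s * e j + c j * (1 - q ^ 2) * τ - ρ j * p ^ 2,
    fun j => c j * (1 - q ^ 2) * τ' + ρ j * q ^ 2, fun j hj => ?_, ?_⟩
  · have hα : ev (mulHom A (s * e j + c j * (1 - q ^ 2) * τ - ρ j * p ^ 2)) =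
        N j / (1 + P ^ 2) := by
      rw [map_sub, map_sub, map_add, map_add, map_mul _ s, map_mul _ (mulHom A s), hs1, he,
        map_mul _ _ τ, map_mul _ (c j), map_mul ev _ (mulHom A τ), map_mul ev (mulHom A (c j)),
        hres, map_mul _ (ρ j), map_mul ev _ (mulHom A (p ^ 2)), hres_alg, map_pow, map_pow]
      field_simp
      ring
    have hβ : ev (mulHom A (c j * (1 - q ^ 2) * τ' + ρ j * q ^ 2)) = N j / (1 + P ^ 2) := by
      rw [map_add, map_add, map_mul _ _ τ', map_mul _ (c j), map_mul ev _ (mulHom A τ'),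
        map_mul ev (mulHom A (c j)), hres, map_mul _ (ρ j), map_mul ev _ (mulHom A (q ^ 2)),
        hres_alg, map_pow, map_pow, hq]
      ring
    have hpos : 0 < K * (N j / (1 + P ^ 2)) := by
      have h1 := sum_Ico_sub_ite_pos hm hmn (mem_range.mp hj)
      have h2 : K * (N j / (1 + P ^ 2)) = K ^ 2 * (∑ i ∈ Ico (j + 1) (k + 2),
          ((m : ℝ) - if i < m then ((k + 2 : ℕ) : ℝ) else 0)) / (1 + P ^ 2) := by
        simp only [hN]
        ring
      rw [h2]
      positivity
    simp only [hα, hβ]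
    exact ⟨hpos, hpos⟩
  · change T = ∑ j ∈ range (k + 1), (u ⊗ₜ 1) ^ j * (1 ⊗ₜ u) ^ (k - j) * _
    change _ = delta u ^ 2 * ∑ j ∈ range (k + 1), (u ⊗ₜ 1) ^ j * (1 ⊗ₜ u) ^ (k - j) * e j at hT
    have h1 : ∀ j ∈ range (k + 1), (u ⊗ₜ 1) ^ j * ((1 : A) ⊗ₜ[ℝ] u) ^ (k - j) *
        ((s * e j + c j * (1 - q ^ 2) * τ - ρ j * p ^ 2) * delta u ^ 2 +
          (c j * (1 - q ^ 2) * τ' + ρ j * q ^ 2) * delta u' ^ 2) =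
        s * delta u ^ 2 * ((u ⊗ₜ 1) ^ j * ((1 : A) ⊗ₜ[ℝ] u) ^ (k - j) * e j) +
          (1 - q ^ 2) * T * ((u ⊗ₜ 1) ^ j * ((1 : A) ⊗ₜ[ℝ] u) ^ (k - j) * c j) := fun j _ => by
      rw [← hτ]
      linear_combination (u ⊗ₜ 1) ^ j * ((1 : A) ⊗ₜ[ℝ] u) ^ (k - j) * ρ j * hsq
    rw [sum_congr rfl h1, sum_add_distrib, ← mul_sum, ← mul_sum, ← hc]
    linear_combination s * hT - T * hgeom

/-- The tangent tensor of `f`, `g` of orders `m < n`, written with the powers of an arbitrary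
uniformizer `t`. -/
lemma exists_derivTensor_eq [IsDomain A] (D : Derivation ℝ A A) {u u' φ ψ t w : A}
    (hunit : ∀ f, ev f ≠ 0 → IsUnit f) (hdvd : ∀ f, ev f = 0 → u ∣ f) (hu0 : ev u = 0)
    (hu : u ≠ 0) (hI : ∀ r, mulHom A r = 0 → ∃ x y, r = x * delta u + y * delta u')
    (hDu : ev (D u) ≠ 0) (hφ : ev φ ≠ 0) (hψ : ev ψ ≠ 0) (hw : ev w ≠ 0) (ht : u = t * w)
    {m n : ℕ} (hm : 1 ≤ m) (hmn : m < n) :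
    ∃ c : ℝ, c ≠ 0 ∧ ∃ α β : ℕ → A ⊗[ℝ] A,
      (∀ j ∈ range (n - 1), 0 < c * ev (mulHom A (α j)) ∧ 0 < c * ev (mulHom A (β j))) ∧
      derivTensor D (φ * u ^ m) (ψ * u ^ n) = (1 ⊗ₜ (t ^ (m - 1))) *
        ∑ j ∈ range (n - 1), ((t ^ j) ⊗ₜ (t ^ (n - 2 - j))) *
          (α j * delta u ^ 2 + β j * delta u' ^ 2) := by
  obtain ⟨α, β, hpos, h⟩ := exists_reducedTensor_eq ev D hunit hdvd hu0 hu hI hDu hφ hψ hm hmn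
  -- The powers of `w` from `u = t w`; their total exponent does not depend on `j`, so all residues
  -- change by the same factor.
  set γ : ℕ → A ⊗[ℝ] A := fun j => (w ^ j) ⊗ₜ (w ^ (n - 2 - j) * w ^ (m - 1)) with hγ
  have hγres : ∀ j ∈ range (n - 1), ev (mulHom A (γ j)) = ev w ^ (n - 2 + (m - 1)) := by
    intro j hj
    have hj := mem_range.mp hj
    simp only [hγ, Algebra.TensorProduct.lmul'_apply_tmul, ← pow_add, map_pow]
    congr 1
    omega
  have hw2 : 0 < (ev w ^ (n - 2 + (m - 1))) ^ 2 := by positivity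
  refine ⟨ev φ * ev ψ * ev (D u) * ev w ^ (n - 2 + (m - 1)),
    mul_ne_zero (mul_ne_zero (mul_ne_zero hφ hψ) hDu) (pow_ne_zero _ hw),
    fun j => γ j * α j, fun j => γ j * β j, fun j hj => ?_, ?_⟩
  · have h1 := mul_pos hw2 (hpos j hj).1
    have h2 := mul_pos hw2 (hpos j hj).2
    simp only [map_mul, hγres j hj]
    constructor
    · convert! h1 using 1; ring
    · convert! h2 using 1; ring
  · rw [derivTensor_eq D φ ψ u hm hmn, h, mul_sum, mul_sum]
    refine sum_congr rfl fun j _ => ?_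
    have h1 : (1 ⊗ₜ (u ^ (m - 1))) * ((u ⊗ₜ 1) ^ j * (1 ⊗ₜ u) ^ (n - 2 - j)) =
        (1 ⊗ₜ (t ^ (m - 1))) * ((t ^ j) ⊗ₜ (t ^ (n - 2 - j))) * γ j := by
      simp only [hγ, ht, Algebra.TensorProduct.tmul_pow, Algebra.TensorProduct.tmul_mul_tmul,
        one_pow, one_mul, mul_one, mul_pow]
      congr 1
      ring
    linear_combination (α j * delta u ^ 2 + β j * delta u' ^ 2) * h1

end Decomposition
-- Normalization over a Dedekind base.
section Normalization

open Polynomial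

/-- The normalization of a domain that is finite over a Dedekind domain of characteristic zero is
again such a domain. -/
lemma isDedekindDomain_integralClosure (R S : Type*) [CommRing R] [IsDedekindDomain R]
    [CharZero R] [CommRing S] [IsDomain S] [Algebra R S] [FaithfulSMul R S] [Module.Finite R S] :
    IsDedekindDomain (integralClosure S (FractionRing S)) ∧
      Module.Finite R (integralClosure S (FractionRing S)) := by
  let : Algebra (FractionRing R) (FractionRing S) := FractionRing.liftAlgebra R _
  have : IsScalarTower R (FractionRing R) (FractionRing S) :=
    FractionRing.isScalarTower_liftAlgebra R _
  have : FiniteDimensional (FractionRing R) (FractionRing S) :=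
    .of_isLocalization R S (nonZeroDivisors R)
  have : CharZero (FractionRing R) :=
    charZero_of_injective_algebraMap (IsFractionRing.injective R (FractionRing R))
  -- As `S` is integral over `R`, integrality over `S` and over `R` agree, so results on integral
  -- closures in finite separable extensions apply.
  have : IsIntegralClosure (integralClosure S (FractionRing S)) R (FractionRing S) := by
    refine ⟨Subtype.val_injective, fun {x} => ⟨fun hx => ⟨⟨x, hx.tower_top⟩, rfl⟩, ?_⟩⟩
    rintro ⟨y, rfl⟩
    exact isIntegral_trans (R := R) (A := S) _ y.2
  exact ⟨IsIntegralClosure.isDedekindDomain R (FractionRing R) (FractionRing S) _,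
    IsIntegralClosure.finite R (FractionRing R) (FractionRing S) _⟩

end Normalization

/-! ### Noether normalization of the curve and two functions generating its ring near the point. -/

section Curve

variable {F : MvPolynomial (Fin 2) ℝ}

lemma toCoordRing_eq_zero_iff {p : MvPolynomial (Fin 2) ℝ} : toCoordRing F p = 0 ↔ F ∣ p := by
  rw [← Ideal.mem_span_singleton]
  exact Ideal.Quotient.eq_zero_iff_mem

lemma toCoordRing_surjective : Function.Surjective (toCoordRing F) :=
  Ideal.Quotient.mk_surjective

lemma isDomain_coordRing (hF : Irreducible F) : IsDomain (CoordRing F) := by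
  have : (Ideal.span {F}).IsPrime :=
    (Ideal.span_singleton_prime hF.ne_zero).mpr hF.prime
  exact inferInstanceAs (IsDomain (MvPolynomial (Fin 2) ℝ ⧸ Ideal.span {F}))

lemma eq_zero_of_toCoordRing_eq_zero (hF : Irreducible F) (hline : F.totalDegree ≠ 1)
    {p : MvPolynomial (Fin 2) ℝ} (hp : p.totalDegree ≤ 1) (h : toCoordRing F p = 0) : p = 0 := by
  obtain ⟨q, rfl⟩ := toCoordRing_eq_zero_iff.mp h
  by_contra hne
  obtain ⟨hF0, hq0⟩ := mul_ne_zero_iff.mp hne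
  rw [MvPolynomial.totalDegree_mul_of_isDomain hF0 hq0] at hp
  have h0 : F.totalDegree = 0 := by omega
  rw [MvPolynomial.totalDegree_eq_zero_iff_eq_C] at h0
  refine hF.not_isUnit ?_
  rw [h0] at hF0 ⊢
  exact (isUnit_iff_ne_zero.mpr fun h => hF0 (by rw [h, map_zero])).map MvPolynomial.C

/-- With transcendence degree at least two, the generators `x, y` would be algebraically
independent, contradicting `F = 0`. -/
lemma lt_two_of_injective_coordRing (hF : Irreducible F) {s : ℕ}
    {g : MvPolynomial (Fin s) ℝ →ₐ[ℝ] CoordRing F} (hg : Function.Injective g) : s < 2 := by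
  have := isDomain_coordRing hF
  by_contra! hs
  have h1 : AlgebraicIndependent ℝ (fun i => g (MvPolynomial.X i)) := by
    have h2 : MvPolynomial.aeval (fun i => g (MvPolynomial.X i)) = g := by ext; simp
    rwa [AlgebraicIndependent, h2]
  have h2 : Cardinal.mk (Fin 2) ≤ Algebra.trdeg ℝ (CoordRing F) := by
    refine le_trans ?_ (by simpa using h1.lift_cardinalMk_le_trdeg)
    simpa using hs
  have h3 : MvPolynomial.aeval (fun i => toCoordRing F (MvPolynomial.X i)) = toCoordRing F := by
    ext; simp
  have h4 : Algebra.adjoin ℝ (Set.range fun i => toCoordRing F (MvPolynomial.X i)) = ⊤ := by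
    rw [Algebra.adjoin_range_eq_range_aeval, h3, AlgHom.range_eq_top]
    exact toCoordRing_surjective
  have : Algebra.IsAlgebraic (Algebra.adjoin ℝ
      (Set.range fun i => toCoordRing F (MvPolynomial.X i))) (CoordRing F) :=
    ⟨fun x => isAlgebraic_algebraMap (A := CoordRing F) (⟨x, h4 ▸ Algebra.mem_top⟩ :
      Algebra.adjoin ℝ (Set.range fun i => toCoordRing F (MvPolynomial.X i)))⟩
  have h5 := (Algebra.IsAlgebraic.isTranscendenceBasis_of_le_trdeg_of_finite ℝ
    (fun i => toCoordRing F (MvPolynomial.X i)) h2).1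
  rw [AlgebraicIndependent, h3] at h5
  exact hF.ne_zero (h5 (by rw [map_zero, toCoordRing_eq_zero_iff]))

/-- The point gives a map to `ℝ`, injective on a field, that kills `x` minus its value; but this
linear polynomial is nonzero on `C`. -/
lemma not_isField_coordRing (hline : F.totalDegree ≠ 1) (hF : Irreducible F) (ξ : RealPoint F) :
    ¬ IsField (CoordRing F) := fun h => by
  let := h.toField
  set η : CoordRing F →+* ℝ := (ξ : NormRing F →+* ℝ).comp (algebraMap _ _) with hη
  have h1 : ∀ c : ℝ, η (toCoordRing F (MvPolynomial.C c)) = c := fun c => by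
    rw [← MvPolynomial.algebraMap_eq, AlgHom.commutes, hη, RingHom.comp_apply,
      ← IsScalarTower.algebraMap_apply]
    exact ξ.commutes c
  have h2 := eq_zero_of_toCoordRing_eq_zero hF hline
    (p := MvPolynomial.X 0 - MvPolynomial.C (η (toCoordRing F (MvPolynomial.X 0))))
    ((MvPolynomial.totalDegree_sub_C_le _ _).trans (MvPolynomial.totalDegree_X _).le)
    (η.injective (by rw [map_sub, map_sub, h1, sub_self, map_zero]))
  have h3 := congrArg (MvPolynomial.coeff (Finsupp.single 0 1)) h2
  simp [MvPolynomial.coeff_X, MvPolynomial.coeff_C,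
    (Finsupp.single_ne_zero.mpr (one_ne_zero (α := ℕ))).symm] at h3

/-- Noether normalization of a plane curve that has a real point on its normalization. -/
lemma exists_aeval_injective_finite (hF : Irreducible F) (hline : F.totalDegree ≠ 1)
    (ξ : RealPoint F) : ∃ z : CoordRing F,
      Function.Injective (Polynomial.aeval (R := ℝ) z) ∧ (Polynomial.aeval (R := ℝ) z).Finite := by
  have := isDomain_coordRing hF
  have : Algebra.FiniteType ℝ (CoordRing F) :=
    Algebra.FiniteType.of_surjective (toCoordRing F) toCoordRing_surjective
  obtain ⟨s, g, hg, hfin⟩ := exists_finite_inj_algHom_of_fg ℝ (CoordRing F)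
  have hs := lt_two_of_injective_coordRing hF hg
  interval_cases s
  · have h1 : (g.toRingHom.comp MvPolynomial.C).Finite :=
      RingHom.Finite.comp hfin
        (RingHom.Finite.of_surjective _ (MvPolynomial.C_surjective (Fin 0)))
    have h2 : g.toRingHom.comp MvPolynomial.C = algebraMap ℝ (CoordRing F) := g.comp_algebraMap
    rw [h2, RingHom.finite_algebraMap] at h1
    exact absurd (isField_of_isIntegral_of_isField' (Field.toIsField ℝ))
      (not_isField_coordRing hline hF ξ)
  · have h1 : Polynomial.aeval (R := ℝ) (g (MvPolynomial.X 0)) =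
        g.comp (MvPolynomial.uniqueAlgEquiv ℝ (Fin 1)).symm.toAlgHom := by
      ext; simp
    refine ⟨g (MvPolynomial.X 0), ?_, ?_⟩
    · rw [h1]
      exact hg.comp (AlgEquiv.injective _)
    · rw [h1]
      exact AlgHom.Finite.comp hfin (AlgHom.Finite.of_surjective _ (AlgEquiv.surjective _))

lemma normRing_isDedekindDomain_and_exists_finite (hF : Irreducible F)
    (hline : F.totalDegree ≠ 1) (ξ : RealPoint F) : IsDedekindDomain (NormRing F) ∧
      ∃ z : NormRing F, Function.Injective (Polynomial.aeval (R := ℝ) z) ∧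
        (Polynomial.aeval (R := ℝ) z).Finite := by
  have := isDomain_coordRing hF
  obtain ⟨z, hinj, hfin⟩ := exists_aeval_injective_finite hF hline ξ
  let := (Polynomial.aeval (R := ℝ) z).toRingHom.toAlgebra
  have : Module.Finite (Polynomial ℝ) (CoordRing F) := hfin
  have : FaithfulSMul (Polynomial ℝ) (CoordRing F) :=
    (faithfulSMul_iff_algebraMap_injective _ _).mpr hinj
  obtain ⟨hD, hN⟩ := isDedekindDomain_integralClosure (Polynomial ℝ) (CoordRing F)
  have h1 : (Polynomial.aeval (R := ℝ) (algebraMap (CoordRing F) (NormRing F) z)).toRingHom =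
      algebraMap (Polynomial ℝ) (integralClosure (CoordRing F) (FractionRing (CoordRing F))) := by
    rw [IsScalarTower.algebraMap_eq (Polynomial ℝ) (CoordRing F)
      (integralClosure (CoordRing F) (FractionRing (CoordRing F)))]
    exact RingHom.ext fun p => Polynomial.aeval_algebraMap_apply (NormRing F) z p
  have h3 := RingHom.finite_algebraMap.mpr hN
  refine ⟨hD, algebraMap (CoordRing F) (NormRing F) z, ?_, ?_⟩
  · have h2 : Function.Injective (algebraMap (CoordRing F) (NormRing F)) := fun a b h =>
      IsFractionRing.injective (CoordRing F) (FractionRing (CoordRing F))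
        (congrArg Subtype.val h)
    intro p q hpq
    rw [Polynomial.aeval_algebraMap_apply, Polynomial.aeval_algebraMap_apply] at hpq
    exact hinj (h2 hpq)
  · change (Polynomial.aeval (R := ℝ) (algebraMap (CoordRing F) (NormRing F) z)).toRingHom.Finite
    rw [h1]
    exact h3

/-- A real point of the normalization of a plane curve has two functions that generate its maximal
ideal and, up to denominators that do not vanish at the point, the whole coordinate ring. -/
lemma exists_pair_generating (hF : Irreducible F) (hline : F.totalDegree ≠ 1) (ξ : RealPoint F) :
    ∃ a b : NormRing F, a ≠ 0 ∧ Ideal.span {a, b} = pointIdeal ξ ∧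
      ∀ f, ∃ s ∈ Algebra.adjoin ℝ {a, b}, ξ s ≠ 0 ∧ s * f ∈ Algebra.adjoin ℝ {a, b} := by
  obtain ⟨hD, z, hinj, hfin⟩ := normRing_isDedekindDomain_and_exists_finite hF hline ξ
  set a := z - algebraMap ℝ (NormRing F) (ξ z) with ha
  have ha0 : a ≠ 0 := fun h => by
    have h1 : Polynomial.aeval z (Polynomial.X - Polynomial.C (ξ z)) =
        Polynomial.aeval (R := ℝ) z 0 := by simpa using h
    exact Polynomial.X_sub_C_ne_zero _ (hinj h1)
  have haξ : a ∈ pointIdeal ξ := by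
    change ξ a = 0
    simp [ha]
  -- In a Dedekind domain, a nonzero element of an ideal extends to a pair of generators. Keeping
  -- `a` as one of them makes the normalization finite over `ℝ[a, b]`.
  obtain ⟨b, hb⟩ := IsDedekindDomain.exists_sup_span_eq
    ((Ideal.span_singleton_le_iff_mem _).mpr haξ)
    (by simpa only [ne_eq, Submodule.zero_eq_bot, Ideal.span_singleton_eq_bot] using ha0)
  have hspan : Ideal.span {a, b} = pointIdeal ξ := by rw [← hb, Ideal.span_insert]
  have hbξ : b ∈ pointIdeal ξ := hspan ▸ Ideal.subset_span (by simp)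
  refine ⟨a, b, ha0, hspan, ?_⟩
  set B := Algebra.adjoin ℝ {a, b} with hB
  have haB : a ∈ B := Algebra.subset_adjoin (by simp)
  have hbB : b ∈ B := Algebra.subset_adjoin (by simp)
  have hzB : z ∈ B := by
    have : z = a + algebraMap ℝ (NormRing F) (ξ z) := by rw [ha]; ring
    rw [this]
    exact add_mem haB (B.algebraMap_mem _)
  have hfinB : Module.Finite B (NormRing F) := by
    rw [← RingHom.finite_algebraMap]
    have h1 : (Polynomial.aeval (R := ℝ) z).toRingHom =
        (algebraMap B (NormRing F)).comp (Polynomial.aeval (R := ℝ) (⟨z, hzB⟩ : B)).toRingHom := by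
      ext <;> simp
    have h2 : (Polynomial.aeval (R := ℝ) z).toRingHom.Finite := hfin
    rw [h1] at h2
    exact RingHom.Finite.of_comp_finite h2
  set n : Ideal B := RingHom.ker ((ξ : NormRing F →+* ℝ).comp (algebraMap B (NormRing F))) with hn
  set Q := NormRing F ⧸ LinearMap.range (Algebra.linearMap B (NormRing F))
  -- Every `f` is its value at the point plus `a c + b d`, so `Q = n Q`; by Nakayama some `s ∈ 1 +
  -- n` kills `Q`, and this `s` is a common denominator.
  have hle : (⊤ : Submodule B Q) ≤ n • ⊤ := by
    rintro x -
    obtain ⟨f, rfl⟩ := Submodule.Quotient.mk_surjective _ x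
    have hf : f - algebraMap ℝ (NormRing F) (ξ f) ∈ Ideal.span {a, b} := by
      rw [hspan]
      change ξ _ = 0
      simp
    obtain ⟨c, d, hcd⟩ := Ideal.mem_span_pair.mp hf
    have h1 : f = algebraMap B (NormRing F) (algebraMap ℝ B (ξ f)) +
        ((⟨a, haB⟩ : B) • c + (⟨b, hbB⟩ : B) • d) := by
      rw [← sub_eq_iff_eq_add']
      refine hcd.symm.trans ?_
      rw [mul_comm c, mul_comm d]
      rfl
    have h2 : (Submodule.Quotient.mk f : Q) = (⟨a, haB⟩ : B) • Submodule.Quotient.mk c +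
        (⟨b, hbB⟩ : B) • Submodule.Quotient.mk d := by
      rw [← Submodule.Quotient.mk_smul, ← Submodule.Quotient.mk_smul, ← Submodule.Quotient.mk_add,
        Submodule.Quotient.eq]
      nth_rw 1 [h1]
      rw [add_sub_cancel_right]
      exact ⟨algebraMap ℝ B (ξ f), rfl⟩
    rw [h2]
    exact add_mem (Submodule.smul_mem_smul haξ Submodule.mem_top)
      (Submodule.smul_mem_smul hbξ Submodule.mem_top)
  obtain ⟨s, hs1, hs⟩ := Submodule.exists_sub_one_mem_and_smul_eq_zero_of_fg_of_le_smul n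
    (⊤ : Submodule B Q) Module.Finite.fg_top hle
  refine fun f => ⟨s, s.2, ?_, ?_⟩
  · have h1 : ξ ((s : NormRing F) - 1) = 0 := hs1
    rw [map_sub, map_one, sub_eq_zero] at h1
    rw [h1]
    exact one_ne_zero
  · have h1 := hs (Submodule.Quotient.mk f) Submodule.mem_top
    rw [← Submodule.Quotient.mk_smul, Submodule.Quotient.mk_eq_zero] at h1
    obtain ⟨y, hy⟩ := h1
    have h2 : (s : NormRing F) * f = y := hy.symm
    rw [h2]
    exact y.2

end Curve
-- The discrete valuation ring at the point.
section LocalRing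

variable {F : MvPolynomial (Fin 2) ℝ} {ξ : RealPoint F}

lemma evalAt_algebraMap (f : NormRing F) : evalAt ξ (algebraMap _ _ f) = ξ f :=
  IsLocalization.lift_eq (M := (pointIdeal ξ).primeCompl) (g := (ξ : NormRing F →+* ℝ)) _ f

lemma mem_maximalIdeal_iff {f : LocalRingAt ξ} :
    f ∈ IsLocalRing.maximalIdeal (LocalRingAt ξ) ↔ evalAt ξ f = 0 := by
  have hmax : (RingHom.ker (evalAt ξ : LocalRingAt ξ →+* ℝ)).IsMaximal :=
    RingHom.ker_isMaximal_of_surjective _ fun c => ⟨algebraMap ℝ _ c, (evalAt ξ).commutes c⟩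
  rw [← IsLocalRing.eq_maximalIdeal hmax]
  rfl

lemma isUnit_of_evalAt_ne_zero (f : LocalRingAt ξ) (hf : evalAt ξ f ≠ 0) : IsUnit f := by
  by_contra h
  exact hf (mem_maximalIdeal_iff.mp ((IsLocalRing.mem_maximalIdeal f).mpr h))

lemma isDomain_localRingAt (hF : Irreducible F) : IsDomain (LocalRingAt ξ) := by
  have := isDomain_coordRing hF
  have : IsDomain (NormRing F) := inferInstanceAs
    (IsDomain (integralClosure (CoordRing F) (FractionRing (CoordRing F))))
  exact IsLocalization.isDomain_of_le_nonZeroDivisors (LocalRingAt ξ)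
    (pointIdeal ξ).primeCompl_le_nonZeroDivisors

lemma isDiscreteValuationRing_localRingAt [IsDomain (LocalRingAt ξ)] (hF : Irreducible F)
    (hline : F.totalDegree ≠ 1) : IsDiscreteValuationRing (LocalRingAt ξ) := by
  obtain ⟨hD, -⟩ := normRing_isDedekindDomain_and_exists_finite hF hline ξ
  obtain ⟨a, b, ha, hab, -⟩ := exists_pair_generating hF hline ξ
  refine IsLocalization.AtPrime.isDiscreteValuationRing_of_dedekind_domain (NormRing F)
    (P := pointIdeal ξ) (fun h => ha ?_) _
  have : a ∈ pointIdeal ξ := hab ▸ Ideal.subset_span (by simp)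
  rwa [h] at this

lemma HasVal.unique {f : LocalRingAt ξ} {k l : ℕ} (hk : HasVal ξ f k) (hl : HasVal ξ f l) :
    k = l := by
  by_contra h
  rcases lt_or_gt_of_ne h with h | h
  · exact hk.2 (Ideal.pow_le_pow_right h hl.1)
  · exact hl.2 (Ideal.pow_le_pow_right h hk.1)

lemma IsUniformizer.maximalIdeal_eq [IsDomain (LocalRingAt ξ)]
    [IsDiscreteValuationRing (LocalRingAt ξ)] {t : LocalRingAt ξ}
    (ht : IsUniformizer ξ t) :
    IsLocalRing.maximalIdeal (LocalRingAt ξ) = Ideal.span {t} := by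
  obtain ⟨h1, h2⟩ := ht
  obtain ⟨ϖ, hϖ⟩ := IsDiscreteValuationRing.exists_irreducible (LocalRingAt ξ)
  rw [hϖ.maximalIdeal_eq] at h1 h2 ⊢
  rw [pow_one, Ideal.mem_span_singleton] at h1
  obtain ⟨c, rfl⟩ := h1
  have hc : IsUnit c := by
    by_contra h
    rw [← mem_nonunits_iff, ← IsLocalRing.mem_maximalIdeal, hϖ.maximalIdeal_eq,
      Ideal.mem_span_singleton] at h
    refine h2 ?_
    rw [Ideal.span_singleton_pow, Ideal.mem_span_singleton, pow_succ, pow_one]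
    exact mul_dvd_mul_left _ h
  exact (Ideal.span_singleton_mul_right_unit hc ϖ).symm

lemma IsUniformizer.ne_zero {t : LocalRingAt ξ} (ht : IsUniformizer ξ t) : t ≠ 0 := fun h =>
  ht.2 (h ▸ zero_mem _)

variable {t : LocalRingAt ξ} (ht : IsLocalRing.maximalIdeal (LocalRingAt ξ) = Ideal.span {t})
  (ht0 : t ≠ 0)

include ht in
lemma evalAt_eq_zero_iff {f : LocalRingAt ξ} : evalAt ξ f = 0 ↔ t ∣ f := by
  rw [← mem_maximalIdeal_iff, ht, Ideal.mem_span_singleton]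

include ht ht0 in
lemma hasVal_iff [IsDomain (LocalRingAt ξ)] {f : LocalRingAt ξ} {k : ℕ} :
    HasVal ξ f k ↔ ∃ φ, evalAt ξ φ ≠ 0 ∧ f = φ * t ^ k := by
  simp only [HasVal, ht, Ideal.span_singleton_pow, Ideal.mem_span_singleton]
  constructor
  · rintro ⟨⟨φ, rfl⟩, h⟩
    refine ⟨φ, fun h0 => h ?_, mul_comm _ _⟩
    rw [pow_succ]
    exact mul_dvd_mul_left _ ((evalAt_eq_zero_iff ht).mp h0)
  · rintro ⟨φ, hφ, rfl⟩
    refine ⟨dvd_mul_left _ _, fun h => hφ ((evalAt_eq_zero_iff ht).mpr ?_)⟩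
    rw [pow_succ'] at h
    exact (mul_dvd_mul_iff_right (pow_ne_zero k ht0)).mp h

include ht ht0 in
lemma exists_hasVal [IsDomain (LocalRingAt ξ)] [IsDiscreteValuationRing (LocalRingAt ξ)]
    {f : LocalRingAt ξ} (hf : f ≠ 0) :
    ∃ k, HasVal ξ f k := by
  have hirr : Irreducible t :=
    (IsDiscreteValuationRing.irreducible_iff_uniformizer t).mpr ht
  obtain ⟨k, w, hw⟩ := IsDiscreteValuationRing.eq_unit_mul_pow_irreducible hf hirr
  exact ⟨k, (hasVal_iff ht ht0).mpr ⟨w, (w.isUnit.map (evalAt ξ)).ne_zero, hw⟩⟩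

end LocalRing

/-! ### A uniformizer among the two generators. -/

section Generators

variable {F : MvPolynomial (Fin 2) ℝ} {ξ : RealPoint F}

lemma exists_isUniformizer_generating [IsDomain (LocalRingAt ξ)]
    [IsDiscreteValuationRing (LocalRingAt ξ)] (hF : Irreducible F) (hline : F.totalDegree ≠ 1) :
    ∃ u u' : LocalRingAt ξ, IsUniformizer ξ u ∧
      ∀ f : LocalRingAt ξ, ∃ g ∈ Algebra.adjoin ℝ {u, u'}, IsUnit g ∧
        f * g ∈ Algebra.adjoin ℝ {u, u'} := by
  obtain ⟨a, b, -, hab, hgen⟩ := exists_pair_generating hF hline ξ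
  set ι : NormRing F →ₐ[ℝ] LocalRingAt ξ := IsScalarTower.toAlgHom ℝ _ _ with hι
  have hadj : ∀ f ∈ Algebra.adjoin ℝ {a, b}, ι f ∈ Algebra.adjoin ℝ {ι a, ι b} := fun f hf => by
    rw [← Set.image_pair, ← AlgHom.map_adjoin]
    exact ⟨f, hf, rfl⟩
  have hfrac : ∀ f : LocalRingAt ξ, ∃ g ∈ Algebra.adjoin ℝ {ι a, ι b}, IsUnit g ∧
      f * g ∈ Algebra.adjoin ℝ {ι a, ι b} := by
    intro f
    obtain ⟨⟨p, q⟩, hpq⟩ := IsLocalization.surj (pointIdeal ξ).primeCompl f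
    obtain ⟨r, hr, hrξ, hrp⟩ := hgen p
    obtain ⟨s, hs, hsξ, hsq⟩ := hgen q
    have hq : ξ q ≠ 0 := q.2
    have hpq' : f * ι q = ι p := hpq
    refine ⟨ι (r * (s * q)), hadj _ (mul_mem hr hsq), ?_, ?_⟩
    · refine isUnit_of_evalAt_ne_zero _ ?_
      rw [hι, IsScalarTower.toAlgHom_apply, evalAt_algebraMap, map_mul, map_mul]
      exact mul_ne_zero hrξ (mul_ne_zero hsξ hq)
    · have h : f * ι (r * (s * q)) = ι (s * (r * p)) := by
        simp only [map_mul, ← hpq']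
        ring
      rw [h]
      exact hadj _ (mul_mem hs hrp)
  have hspan : IsLocalRing.maximalIdeal (LocalRingAt ξ) = Ideal.span {ι a, ι b} := by
    rw [← IsLocalization.AtPrime.map_eq_maximalIdeal (pointIdeal ξ), ← hab, Ideal.map_span,
      Set.image_pair]
    rfl
  have hmem : ∀ f ∈ ({ι a, ι b} : Set (LocalRingAt ξ)),
      f ∈ IsLocalRing.maximalIdeal (LocalRingAt ξ) ^ 1 := fun f hf => by
    rw [pow_one, hspan]
    exact Ideal.subset_span hf
  by_cases ha : IsUniformizer ξ (ι a)
  · exact ⟨ι a, ι b, ha, hfrac⟩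
  by_cases hb : IsUniformizer ξ (ι b)
  · exact ⟨ι b, ι a, hb, by rwa [Set.pair_comm]⟩
  · have ha2 : ι a ∈ IsLocalRing.maximalIdeal (LocalRingAt ξ) ^ 2 := by
      by_contra h
      exact ha ⟨hmem _ (by simp), h⟩
    have hb2 : ι b ∈ IsLocalRing.maximalIdeal (LocalRingAt ξ) ^ 2 := by
      by_contra h
      exact hb ⟨hmem _ (by simp), h⟩
    -- Were neither generator a uniformizer, the maximal ideal would equal its square.
    have hle : IsLocalRing.maximalIdeal (LocalRingAt ξ) ≤
        IsLocalRing.maximalIdeal (LocalRingAt ξ) ^ 2 := by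
      conv_lhs => rw [hspan]
      rw [Ideal.span_le]
      rintro f (rfl | rfl) <;> assumption
    obtain ⟨ϖ, hϖ⟩ := IsDiscreteValuationRing.exists_irreducible (LocalRingAt ξ)
    have hϖ1 := (hasVal_iff hϖ.maximalIdeal_eq hϖ.ne_zero (k := 1)).mpr
      ⟨1, by simp, (by rw [pow_one, one_mul] : ϖ = 1 * ϖ ^ 1)⟩
    exact absurd (hle (by simpa using hϖ1.1)) hϖ1.2

end Generators

/-! ### Existence and uniqueness of the contact orders. -/

section ContactOrders

variable {F : MvPolynomial (Fin 2) ℝ} {ξ : RealPoint F}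

lemma germ_injective_of_totalDegree_le_one (hF : Irreducible F) (hline : F.totalDegree ≠ 1)
    {p : MvPolynomial (Fin 2) ℝ} (hp : p.totalDegree ≤ 1) (h : germ ξ p = 0) : p = 0 := by
  have := isDomain_coordRing hF
  have : IsDomain (NormRing F) := inferInstanceAs
    (IsDomain (integralClosure (CoordRing F) (FractionRing (CoordRing F))))
  have h1 : Function.Injective (algebraMap (CoordRing F) (NormRing F)) := fun a b h =>
    IsFractionRing.injective (CoordRing F) (FractionRing (CoordRing F)) (congrArg Subtype.val h)
  have h2 : Function.Injective (algebraMap (NormRing F) (LocalRingAt ξ)) :=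
    IsLocalization.injective _ (pointIdeal ξ).primeCompl_le_nonZeroDivisors
  refine eq_zero_of_toCoordRing_eq_zero hF hline hp (h1 (h2 ?_))
  rw [map_zero, map_zero]
  exact h

lemma linearIndependent_one_x_y (hF : Irreducible F) (hline : F.totalDegree ≠ 1) {a b c : ℝ}
    (h : algebraMap ℝ (LocalRingAt ξ) a + b • xGerm ξ + c • yGerm ξ = 0) :
    a = 0 ∧ b = 0 ∧ c = 0 := by
  set p : MvPolynomial (Fin 2) ℝ := MvPolynomial.C a + b • MvPolynomial.X 0 + c • MvPolynomial.X 1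
    with hp
  have h0 : germ ξ p = 0 := by
    set γ : MvPolynomial (Fin 2) ℝ →ₐ[ℝ] LocalRingAt ξ :=
      (IsScalarTower.toAlgHom ℝ (NormRing F) _).comp
        ((IsScalarTower.toAlgHom ℝ (CoordRing F) _).comp (toCoordRing F))
    change γ p = 0
    rw [hp, map_add, map_add, map_smul, map_smul, ← MvPolynomial.algebraMap_eq, γ.commutes]
    exact h
  have hdeg : p.totalDegree ≤ 1 := by
    refine (MvPolynomial.totalDegree_add _ _).trans (max_le ?_ ?_)
    · refine (MvPolynomial.totalDegree_add _ _).trans (max_le (by simp) ?_)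
      exact (MvPolynomial.totalDegree_smul_le _ _).trans (MvPolynomial.totalDegree_X _).le
    · exact (MvPolynomial.totalDegree_smul_le _ _).trans (MvPolynomial.totalDegree_X _).le
  have hp0 := germ_injective_of_totalDegree_le_one hF hline hdeg h0
  have e0 := congrArg (MvPolynomial.coeff 0) hp0
  have e1 := congrArg (MvPolynomial.coeff (Finsupp.single 0 1)) hp0
  have e2 := congrArg (MvPolynomial.coeff (Finsupp.single 1 1)) hp0
  have h3 : ∀ i : Fin 2, (0 : Fin 2 →₀ ℕ) ≠ Finsupp.single i 1 := fun i =>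
    (Finsupp.single_ne_zero.mpr one_ne_zero).symm
  have h4 : (Finsupp.single 0 1 : Fin 2 →₀ ℕ) ≠ Finsupp.single 1 1 := fun h => by
    simpa using DFunLike.congr_fun h 0
  simp [hp, MvPolynomial.coeff_X, MvPolynomial.coeff_C, h3, (h3 _).symm, h4, h4.symm] at e0 e1 e2
  exact ⟨e0, e1, e2⟩

/-- The orders `0 < m < n` are distinct, so the first nonzero coefficient of a combination
determines its order. -/
lemma setOf_hasVal_span_eq [IsDomain (LocalRingAt ξ)] {t f g : LocalRingAt ξ}
    (ht : IsLocalRing.maximalIdeal (LocalRingAt ξ) = Ideal.span {t}) (ht0 : t ≠ 0) {m n : ℕ}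
    (hm : 1 ≤ m) (hmn : m < n) (hf : HasVal ξ f m) (hg : HasVal ξ g n) :
    {k | ∃ h ∈ Submodule.span ℝ {1, f, g}, h ≠ 0 ∧ HasVal ξ h k} = {0, m, n} := by
  have hne : ∀ {h : LocalRingAt ξ} {k}, HasVal ξ h k → h ≠ 0 := fun h h0 =>
    h.2 (h0 ▸ zero_mem _)
  have h1 : HasVal ξ (1 : LocalRingAt ξ) 0 := (hasVal_iff ht ht0).mpr ⟨1, by simp, by simp⟩
  ext k
  simp only [Set.mem_ofPred_eq, Set.mem_insert_iff, Set.mem_singleton_iff]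
  constructor
  · rintro ⟨h, hh, h0, hk⟩
    obtain ⟨a, b, c, rfl⟩ := Submodule.mem_span_triple.mp hh
    obtain ⟨φ, hφ, rfl⟩ := (hasVal_iff ht ht0).mp hf
    obtain ⟨ψ, hψ, rfl⟩ := (hasVal_iff ht ht0).mp hg
    have htev : evalAt ξ t = 0 := (evalAt_eq_zero_iff ht).mpr dvd_rfl
    rcases eq_or_ne a 0 with rfl | ha
    · rcases eq_or_ne b 0 with rfl | hb
      · rcases eq_or_ne c 0 with rfl | hc
        · simp at h0
        · refine Or.inr (Or.inr (hk.unique ((hasVal_iff ht ht0).mpr ⟨c • ψ, ?_, ?_⟩)))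
          · simpa using ⟨hc, hψ⟩
          · simp
      · refine Or.inr (Or.inl (hk.unique ((hasVal_iff ht ht0).mpr
          ⟨b • φ + c • (ψ * t ^ (n - m)), ?_, ?_⟩)))
        · simpa [htev, (Nat.sub_pos_of_lt hmn).ne'] using ⟨hb, hφ⟩
        · nth_rw 1 [show n = (n - m) + m by omega, pow_add]
          simp only [zero_smul, zero_add, add_mul, smul_mul_assoc, mul_assoc]
    · refine Or.inl (hk.unique ((hasVal_iff ht ht0).mpr
        ⟨a • 1 + b • (φ * t ^ m) + c • (ψ * t ^ n), ?_, by simp⟩))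
      simpa [htev, show m ≠ 0 by omega, show n ≠ 0 by omega] using ha
  · rintro (rfl | rfl | rfl)
    · exact ⟨1, Submodule.subset_span (by simp), hne h1, h1⟩
    · exact ⟨f, Submodule.subset_span (by simp), hne hf, hf⟩
    · exact ⟨g, Submodule.subset_span (by simp), hne hg, hg⟩

lemma span_one_pair_eq {V : Type*} [AddCommGroup V] [Module ℝ V] {e x y f g : V}
    (hf : f ∈ Submodule.span ℝ {e, x, y}) (hg : g ∈ Submodule.span ℝ {e, x, y})
    (hx : x ∈ Submodule.span ℝ {e, f, g}) (hy : y ∈ Submodule.span ℝ {e, f, g}) :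
    Submodule.span ℝ {e, f, g} = Submodule.span ℝ {e, x, y} := by
  apply le_antisymm <;> rw [Submodule.span_le]
  · rintro h (rfl | rfl | rfl)
    exacts [Submodule.subset_span (by simp), hf, hg]
  · rintro h (rfl | rfl | rfl)
    exacts [Submodule.subset_span (by simp), hx, hy]

lemma exists_isContactOrders [IsDomain (LocalRingAt ξ)]
    [IsDiscreteValuationRing (LocalRingAt ξ)] (hF : Irreducible F)
    (hline : F.totalDegree ≠ 1) : ∃ m n, IsContactOrders ξ m n := by
  obtain ⟨t, hirr⟩ := IsDiscreteValuationRing.exists_irreducible (LocalRingAt ξ)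
  have ht := hirr.maximalIdeal_eq
  have ht0 := hirr.ne_zero
  set x := xGerm ξ with hx
  set y := yGerm ξ with hy
  have hind : ∀ {a b c : ℝ}, algebraMap ℝ (LocalRingAt ξ) a + b • x + c • y = 0 →
    a = 0 ∧ b = 0 ∧ c = 0 := linearIndependent_one_x_y hF hline
  suffices ∃ f ∈ Submodule.span ℝ {1, x, y}, ∃ g ∈ Submodule.span ℝ {1, x, y},
      x ∈ Submodule.span ℝ {1, f, g} ∧ y ∈ Submodule.span ℝ {1, f, g} ∧
      ∃ m n, 1 ≤ m ∧ m < n ∧ HasVal ξ f m ∧ HasVal ξ g n by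
    obtain ⟨f, hf, g, hg, hxf, hyg, m, n, hm, hmn, hfm, hgn⟩ := this
    refine ⟨m, n, hm, hmn, ?_⟩
    rw [← setOf_hasVal_span_eq ht ht0 hm hmn hfm hgn, span_one_pair_eq hf hg hxf hyg]
  set x₀ := x - algebraMap ℝ _ (evalAt ξ x) with hx₀
  set y₀ := y - algebraMap ℝ _ (evalAt ξ y) with hy₀
  have hind₀ : ∀ {b c : ℝ}, b • x₀ + c • y₀ = 0 → b = 0 ∧ c = 0 := fun {b c} h => by
    refine (hind (a := -(b * evalAt ξ x + c * evalAt ξ y)) ?_).2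
    rw [← h, hx₀, hy₀]
    simp only [Algebra.algebraMap_eq_smul_one]
    module
  have hx₀0 : x₀ ≠ 0 := fun h => one_ne_zero (hind₀ (b := 1) (c := 0) (by simp [h])).1
  have hy₀0 : y₀ ≠ 0 := fun h => one_ne_zero (hind₀ (b := 0) (c := 1) (by simp [h])).2
  have hpos : ∀ {f : LocalRingAt ξ} {k}, evalAt ξ f = 0 → HasVal ξ f k → 1 ≤ k := by
    intro f k hf hk
    by_contra! h
    obtain rfl : k = 0 := by omega
    exact hk.2 (by simpa using mem_maximalIdeal_iff.mpr hf)
  have hevx : evalAt ξ x₀ = 0 := by simp [hx₀]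
  have hevy : evalAt ξ y₀ = 0 := by simp [hy₀]
  obtain ⟨i, hi⟩ := exists_hasVal ht ht0 hx₀0
  obtain ⟨j, hj⟩ := exists_hasVal ht ht0 hy₀0
  have mem : ∀ (f g h : LocalRingAt ξ) (a b c : ℝ), h = a • 1 + b • f + c • g →
      h ∈ Submodule.span ℝ {1, f, g} := fun f g h a b c e =>
    Submodule.mem_span_triple.mpr ⟨a, b, c, e.symm⟩
  have hxs : x₀ ∈ Submodule.span ℝ {1, x, y} := mem _ _ _ (-evalAt ξ x) 1 0 (by
    rw [hx₀, Algebra.algebraMap_eq_smul_one]; module)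
  have hys : y₀ ∈ Submodule.span ℝ {1, x, y} := mem _ _ _ (-evalAt ξ y) 0 1 (by
    rw [hy₀, Algebra.algebraMap_eq_smul_one]; module)
  have hx' : x = evalAt ξ x • 1 + x₀ := by rw [hx₀, Algebra.algebraMap_eq_smul_one]; module
  have hy' : y = evalAt ξ y • 1 + y₀ := by rw [hy₀, Algebra.algebraMap_eq_smul_one]; module
  have hx₁ : ∀ g, x ∈ Submodule.span ℝ {1, x₀, g} := fun g =>
    mem _ _ _ (evalAt ξ x) 1 0 (by rw [one_smul, zero_smul, add_zero, ← hx'])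
  have hx₂ : ∀ g, x ∈ Submodule.span ℝ {1, g, x₀} := fun g =>
    mem _ _ _ (evalAt ξ x) 0 1 (by rw [one_smul, zero_smul, add_zero, ← hx'])
  have hy₁ : ∀ g, y ∈ Submodule.span ℝ {1, y₀, g} := fun g =>
    mem _ _ _ (evalAt ξ y) 1 0 (by rw [one_smul, zero_smul, add_zero, ← hy'])
  have hy₂ : ∀ g, y ∈ Submodule.span ℝ {1, g, y₀} := fun g =>
    mem _ _ _ (evalAt ξ y) 0 1 (by rw [one_smul, zero_smul, add_zero, ← hy'])
  rcases lt_trichotomy i j with hij | rfl | hij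
  · exact ⟨x₀, hxs, y₀, hys, hx₁ _, hy₂ _, i, j, hpos hevx hi, hij, hi, hj⟩
  · obtain ⟨φ, hφ, hxφ⟩ := (hasVal_iff ht ht0).mp hi
    obtain ⟨ψ, hψ, hyψ⟩ := (hasVal_iff ht ht0).mp hj
    -- For equal orders, this multiple cancels the leading term, so `g` has strictly larger order.
    set c := evalAt ξ ψ / evalAt ξ φ with hc
    set g := y₀ - c • x₀ with hg
    have hg0 : g ≠ 0 := fun h => one_ne_zero (hind₀ (b := -c) (c := 1) (by
      rw [← h, hg]; module)).2
    obtain ⟨n, hn⟩ := exists_hasVal ht ht0 hg0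
    refine ⟨x₀, hxs, g, sub_mem hys (Submodule.smul_mem _ _ hxs),
      hx₁ _,
      mem _ _ _ (evalAt ξ y) c 1 ?_, i, n, hpos hevx hi, ?_, hi, hn⟩
    · rw [hg, one_smul, add_assoc, add_sub_cancel, ← hy']
    · have h1 : evalAt ξ (ψ - c • φ) = 0 := by
        rw [map_sub, map_smul, smul_eq_mul, hc]
        field_simp
        ring
      have h2 : g = (ψ - c • φ) * t ^ i := by
        rw [hg, hxφ, hyψ, sub_mul, smul_mul_assoc]
      obtain ⟨d, hd⟩ := (evalAt_eq_zero_iff ht).mp h1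
      by_contra! h
      refine hn.2 (Ideal.pow_le_pow_right (Nat.succ_le_succ h) ?_)
      rw [h2, hd, ht, Ideal.span_singleton_pow, Ideal.mem_span_singleton]
      exact ⟨d, by rw [Nat.succ_eq_add_one, pow_succ]; ring⟩
  · exact ⟨y₀, hys, x₀, hxs, hx₂ _, hy₁ _, j, i, hpos hevy hj, hij, hj, hi⟩

lemma IsContactOrders.unique {m n m' n' : ℕ} (h : IsContactOrders ξ m n)
    (h' : IsContactOrders ξ m' n') : m = m' ∧ n = n' := by
  obtain ⟨h1, h2, h3⟩ := h
  obtain ⟨h1', h2', h3'⟩ := h'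
  have h4 : ({0, m, n} : Set ℕ) = {0, m', n'} := h3.trans h3'.symm
  have a1 : m ∈ ({0, m', n'} : Set ℕ) := h4 ▸ (by simp)
  have a2 : n ∈ ({0, m', n'} : Set ℕ) := h4 ▸ (by simp)
  simp only [Set.mem_insert_iff, Set.mem_singleton_iff] at a1 a2
  omega

end ContactOrders
-- The derivation `d/ds` and the effect of affine coordinate changes.
section Derivation

variable {A : Type} [CommRing A] [Algebra ℝ A]

lemma derivAlong_spec {s : A} (hs : FreelyGenerates s) (f : A) :
    KaehlerDifferential.D ℝ A f = derivAlong hs f • KaehlerDifferential.D ℝ A s :=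
  (hs _).choose_spec.1

lemma derivAlong_eq {s : A} (hs : FreelyGenerates s) {f a : A}
    (h : KaehlerDifferential.D ℝ A f = a • KaehlerDifferential.D ℝ A s) : derivAlong hs f = a :=
  ((hs _).choose_spec.2 a h).symm

/-- The derivation `d/ds` of `A`. -/
noncomputable def derivationAlong {s : A} (hs : FreelyGenerates s) : Derivation ℝ A A :=
  Derivation.mk'
    { toFun := derivAlong hs
      map_add' := fun f g => derivAlong_eq hs (by
        rw [map_add, derivAlong_spec hs f, derivAlong_spec hs g, add_smul])
      map_smul' := fun c f => derivAlong_eq hs (by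
        rw [Derivation.map_smul, derivAlong_spec hs f, RingHom.id_apply, smul_assoc]) }
    fun f g => derivAlong_eq hs (by
      rw [Derivation.leibniz, derivAlong_spec hs f, derivAlong_spec hs g]
      simp only [LinearMap.coe_mk, AddHom.coe_mk, smul_eq_mul, add_smul, mul_smul])

lemma derivationAlong_self {s : A} (hs : FreelyGenerates s) : derivationAlong hs s = 1 :=
  derivAlong_eq hs (one_smul _ _).symm

lemma tangentTensor_eq {s : A} (hs : FreelyGenerates s) (x y : A) :
    tangentTensor hs x y = derivTensor (derivationAlong hs) x y := rfl

lemma derivTensor_add_smul (D : Derivation ℝ A A) (x y : A) (a b c a' b' c' : ℝ) :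
    derivTensor D (a • 1 + b • x + c • y) (a' • 1 + b' • x + c' • y) =
      (b * c' - b' * c) • derivTensor D x y := by
  have h : ∀ a : ℝ, delta (a • (1 : A)) = 0 := fun a => by
    rw [← Algebra.algebraMap_eq_smul_one, delta_algebraMap]
  simp only [derivTensor, map_add, Derivation.map_smul, Derivation.map_one_eq_zero, smul_zero,
    zero_add, delta_add, delta_smul, h, TensorProduct.tmul_add, TensorProduct.tmul_smul,
    add_mul, mul_add, smul_mul_smul_comm, smul_sub]
  module

end Derivation

variable {F : MvPolynomial (Fin 2) ℝ} {ξ : RealPoint F}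

/-- Write `s - s(ξ) = u g`, differentiate and evaluate at the point: `1 = g(ξ) (D u)(ξ)`. -/
lemma evalAt_deriv_ne_zero {u s : LocalRingAt ξ}
    (hu : IsLocalRing.maximalIdeal (LocalRingAt ξ) = Ideal.span {u})
    (D : Derivation ℝ (LocalRingAt ξ) (LocalRingAt ξ)) (hs : D s = 1) : evalAt ξ (D u) ≠ 0 := by
  obtain ⟨g, hg⟩ := (evalAt_eq_zero_iff hu).mp
    (by simp : evalAt ξ (s - algebraMap ℝ _ (evalAt ξ s)) = 0)
  have hu0 : evalAt ξ u = 0 := (evalAt_eq_zero_iff hu).mpr dvd_rfl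
  have h := congrArg (fun f => evalAt ξ (D f)) hg
  simp only [map_sub, Derivation.map_algebraMap, hs, sub_zero, map_one, Derivation.leibniz,
    smul_eq_mul, map_add, map_mul, hu0, zero_mul, zero_add] at h
  exact right_ne_zero_of_mul_eq_one h.symm

/-- Functions of different orders in `ℝ + ℝ x + ℝ y` vanishing at the point have independent
linear parts. -/
lemma det_ne_zero_of_hasVal [IsDomain (LocalRingAt ξ)] {t f g x y : LocalRingAt ξ}
    (ht : IsLocalRing.maximalIdeal (LocalRingAt ξ) = Ideal.span {t}) (ht0 : t ≠ 0)
    {a b c a' b' c' : ℝ} (hf : a • 1 + b • x + c • y = f) (hg : a' • 1 + b' • x + c' • y = g)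
    {m n : ℕ} (hm : 1 ≤ m) (hmn : m < n) (hfm : HasVal ξ f m) (hgn : HasVal ξ g n) :
    b * c' - b' * c ≠ 0 := by
  intro hdet
  obtain ⟨φ, hφ, hfφ⟩ := (hasVal_iff ht ht0).mp hfm
  obtain ⟨ψ, hψ, hgψ⟩ := (hasVal_iff ht ht0).mp hgn
  have htev : evalAt ξ t = 0 := (evalAt_eq_zero_iff ht).mpr dvd_rfl
  have hfev : evalAt ξ f = 0 := by simp [hfφ, htev, show m ≠ 0 by omega]
  have hgev : evalAt ξ g = 0 := by simp [hgψ, htev, show n ≠ 0 by omega]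
  have hfne : f ≠ 0 := fun h => hfm.2 (h ▸ zero_mem _)
  have hgne : g ≠ 0 := fun h => hgn.2 (h ▸ zero_mem _)
  have key : ∀ p q : ℝ, p * b + q * b' = 0 → p * c + q * c' = 0 → p • f + q • g = 0 := by
    intro p q h1 h2
    have h3 : p • f + q • g = algebraMap ℝ _ (p * a + q * a') := by
      have : p • f + q • g = (p * a + q * a') • 1 + (p * b + q * b') • x +
          (p * c + q * c') • y := by
        rw [← hf, ← hg]
        module
      rw [this, h1, h2, zero_smul, zero_smul, add_zero, add_zero, Algebra.algebraMap_eq_smul_one]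
    have h4 := congrArg (evalAt ξ) h3
    rw [map_add, map_smul, map_smul, hfev, hgev, AlgHom.commutes] at h4
    simp only [smul_zero, add_zero, Algebra.algebraMap_self, RingHom.id_apply] at h4
    rw [h3, ← h4, map_zero]
  have hval : ∀ p q : ℝ, p • f + q • g = 0 → p = 0 := by
    intro p q h
    by_contra hp
    have h1 : HasVal ξ (p • f + q • g) m := (hasVal_iff ht ht0).mpr
      ⟨p • φ + q • (ψ * t ^ (n - m)), by
        simpa [htev, (Nat.sub_pos_of_lt hmn).ne'] using ⟨hp, hφ⟩, by
        nth_rw 1 [hfφ, hgψ, show n = (n - m) + m by omega, pow_add]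
        simp only [add_mul, smul_mul_assoc, mul_assoc]⟩
    exact h1.2 (h ▸ zero_mem _)
  -- With zero determinant, the multipliers `(b', -b)` and `(c', -c)` annihilate the linear parts;
  -- `hval` forces `b' = c' = 0`, so `g` is a constant vanishing at the point.
  have hb' : b' = 0 := hval b' (-b) (key _ _ (by ring) (by linear_combination -hdet))
  have hc' : c' = 0 := hval c' (-c) (key _ _ (by linear_combination hdet) (by ring))
  have h := key 0 1 (by simp [hb']) (by simp [hc'])
  rw [zero_smul, zero_add, one_smul] at h
  exact hgne h

end PlaneCurve

open PlaneCurve in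
theorem mainTheorem4 (F : MvPolynomial (Fin 2) ℝ) (hF : Irreducible F)
    (hline : F.totalDegree ≠ 1) (ξ : PlaneCurve.RealPoint F) :
    (∃! mn : ℕ × ℕ, PlaneCurve.IsContactOrders ξ mn.1 mn.2) ∧
    ∀ m n : ℕ, PlaneCurve.IsContactOrders ξ m n →
    ∀ (s : PlaneCurve.LocalRingAt ξ) (hs : PlaneCurve.FreelyGenerates s)
      (t : PlaneCurve.LocalRingAt ξ), PlaneCurve.IsUniformizer ξ t →
    ∃ ε : ℝ, (ε = 1 ∨ ε = -1) ∧
    ∃ (u₁ u₂ : PlaneCurve.LocalRingAt ξ)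
      (α β : ℕ → PlaneCurve.LocalRingAt ξ ⊗[ℝ] PlaneCurve.LocalRingAt ξ),
      (∀ i ∈ Finset.range (n - 1),
        0 < PlaneCurve.residue ξ (α i) ∧ 0 < PlaneCurve.residue ξ (β i)) ∧
      ε • PlaneCurve.tangentTensor hs (PlaneCurve.xGerm ξ) (PlaneCurve.yGerm ξ) =
        (1 ⊗ₜ[ℝ] (t ^ (m - 1))) *
          ∑ i ∈ Finset.range (n - 1),
            ((t ^ i) ⊗ₜ[ℝ] (t ^ (n - 2 - i))) *
              (α i * PlaneCurve.delta u₁ ^ 2 + β i * PlaneCurve.delta u₂ ^ 2) := by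
  have := isDomain_localRingAt (ξ := ξ) hF
  have := isDiscreteValuationRing_localRingAt (ξ := ξ) hF hline
  refine ⟨?_, fun m n hmn s hs t ht => ?_⟩
  · obtain ⟨m, n, h⟩ := exists_isContactOrders (ξ := ξ) hF hline
    exact ⟨(m, n), h, fun mn h' => Prod.ext (h'.unique h).1 (h'.unique h).2⟩
  obtain ⟨hm, hlt, hset⟩ := hmn
  obtain ⟨u, u', hu, hgen⟩ := exists_isUniformizer_generating (ξ := ξ) hF hline
  have hmax := hu.maximalIdeal_eq
  have hu0 : evalAt ξ u = 0 := (evalAt_eq_zero_iff hmax).mpr dvd_rfl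
  obtain ⟨f, hfV, -, hfm⟩ : m ∈ {k | ∃ f ∈ Submodule.span ℝ {1, xGerm ξ, yGerm ξ}, f ≠ 0 ∧
      HasVal ξ f k} := hset ▸ (by simp)
  obtain ⟨g, hgV, -, hgn⟩ : n ∈ {k | ∃ f ∈ Submodule.span ℝ {1, xGerm ξ, yGerm ξ}, f ≠ 0 ∧
      HasVal ξ f k} := hset ▸ (by simp)
  obtain ⟨a, b, c, hf⟩ := Submodule.mem_span_triple.mp hfV
  obtain ⟨a', b', c', hg⟩ := Submodule.mem_span_triple.mp hgV
  have hdet := det_ne_zero_of_hasVal hmax hu.ne_zero hf hg hm hlt hfm hgn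
  obtain ⟨φ, hφ, hfφ⟩ := (hasVal_iff hmax hu.ne_zero).mp hfm
  obtain ⟨ψ, hψ, hgψ⟩ := (hasVal_iff hmax hu.ne_zero).mp hgn
  obtain ⟨w, hw, huw⟩ := (hasVal_iff ht.maximalIdeal_eq ht.ne_zero).mp hu
  rw [pow_one, mul_comm] at huw
  obtain ⟨d, hd, α, β, hpos, hT⟩ := exists_derivTensor_eq (evalAt ξ) (derivationAlong hs)
    isUnit_of_evalAt_ne_zero (fun f => (evalAt_eq_zero_iff hmax).mp) hu0 hu.ne_zero
    (fun r => exists_eq_of_mulHom_eq_zero hgen)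
    (evalAt_deriv_ne_zero hmax _ (derivationAlong_self hs)) hφ hψ hw huw hm hlt
  rw [← hfφ, ← hgψ, ← hf, ← hg, derivTensor_add_smul, ← tangentTensor_eq] at hT
  set e := b * c' - b' * c with he
  -- The residues of `α, β` have the sign of `d`, and passing back from `f, g` to `x, y` divides by
  -- `e`.
  obtain ⟨ε, hε, hεpos⟩ : ∃ ε : ℝ, (ε = 1 ∨ ε = -1) ∧ 0 < ε * (d * e) := by
    rcases lt_or_gt_of_ne (mul_ne_zero hd hdet) with h | h
    · exact ⟨-1, Or.inr rfl, by linarith⟩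
    · exact ⟨1, Or.inl rfl, by linarith⟩
  have hres : ∀ r : LocalRingAt ξ ⊗[ℝ] LocalRingAt ξ, 0 < d * evalAt ξ (mulHom _ r) →
      0 < residue ξ ((ε / e) • r) := fun r hr => by
    have h1 : residue ξ ((ε / e) • r) =
        ε * (d * e) * (d * evalAt ξ (mulHom _ r)) / (d * e) ^ 2 := by
      rw [map_smul, smul_eq_mul]
      change ε / e * evalAt ξ (mulHom _ r) = _
      field_simp
    rw [h1]
    have := mul_ne_zero hd hdet
    positivity
  refine ⟨ε, hε, u, u', fun i => (ε / e) • α i, fun i => (ε / e) • β i,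
    fun i hi => ⟨hres _ (hpos i hi).1, hres _ (hpos i hi).2⟩, ?_⟩
  have h1 : ε • tangentTensor hs (xGerm ξ) (yGerm ξ) =
      (ε / e) • e • tangentTensor hs (xGerm ξ) (yGerm ξ) := by
    rw [smul_smul, div_mul_cancel₀ _ hdet]
  rw [h1, hT, ← mul_smul_comm, Finset.smul_sum]
  simp only [smul_mul_assoc, ← smul_add, mul_smul_comm]
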